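/- All graphs are finite, simple and undirected. An odd cycle transversal (OCT) of $G$ is a set $S\subseteq V(G)$ such that $G-S$ is bipartite. For a graph $H$, let $H^2$ be the graph with vertices $v_1,v_2$ for each $v\in V(H)$ and with edges $u_1v_1$, $u_2v_2$ for each $uv\in E(H)$ and $v_1v_2$ for each $v\in V(H)$; for $U\subseteq V(H)$ write $U_i=\{v_i : v\in U\}$. **Algorithm OCT-Disjoint-Compression$(H,T)$** ($T$ an OCT of $H$, $B=V(H)\setminus T$). Iterate over the sets $Y\subseteq T_1\cup T_2$ that contain exactly one of $v_1,v_2$ for each $v\in T$. If $Y$ is not a vertex cover of $H^2[T_1\cup T_2]$, go on to the next $Y$. Otherwise let $W$ be the set of vertices of $B_1\cup B_2$ adjacent to some vertex of $(T_1\cup T_2)\setminus Y$, let $Z$ be a minimum vertex cover of $H^2[(B_1\cup B_2)\setminus W]$, let $X=Y\cup W\cup Z$ and $T'=\{v : v_1,v_2\in X\}$; if $|T'|\le |T|-1$, return $T'$. If no $Y$ leads to a return, declare failure. **Compression step on $(G,S)$.** For each nonempty $T\subseteq S$, run OCT-Disjoint-Compression$(H,T)$ with $H=G[V(G)\setminus(S\setminus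 T)]$; as soon as some run returns a set $T'$, output $T'\cup(S\setminus T)$. If all runs fail, declare failure. (The set $T=\emptyset$ need not be tried, because no set has size at most $-1$.) **Iterative compression on $(G,k)$.** Start with the empty graph and the empty solution. Add the vertices of $G$ one at a time, each to the current induced subgraph and to the current solution; whenever the solution has more than $k$ vertices, replace it by the output of the compression step on the current induced subgraph, and declare failure if that step fails. At the end output the current solution. Put $c_k=\sum_{i=1}^{k+1}\binom{k+1}{i}2^i$. The following hold, whatever the orders of enumeration and the choices of minimum vertex covers. 1. Let $S$ be an OCT of $G$ with $|S|=k+1$. If, for some $T\subseteq S$, OCT-Disjoint-Compression$(H,T)$ with $H=G[V(G)\setminus(S\setminus T)]$ returns $T'$, then $T'\cup(S\setminus T)$ is an OCT of $G$ of size at most $k$. The compression step on $(G,S)$ outputs an OCT of $G$ of size at most $k$ if there is one, and declares failure otherwise. In total it tries at most $c_k$ sets $Y$, and exactly $c_k$ if it fails. 2. $c_k=3^{k+1}-1$ for every $k\ge 0$; in particular $c_k=O(3^k)$. 3. There are a program and a polynomial $p$ such that, for every graph $G$ on $n$ vertices and every OCT $S$ of $G$ with $|S|=k+1$, the program on input $(G,S)$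 gives an output that the compression step can give, in at most $c_k\,p(n)$ steps; that is, in $O^*(3^k)$ time. 4. For every graph $G$ on $n$ vertices and every $k\ge 0$, iterative compression on $(G,k)$ outputs an OCT of $G$ of size at most $k$ if there is one, and declares failure otherwise; in total it tries at most $\max(n-k,0)\cdot c_k$ sets $Y$. 5. There are a program and a polynomial $p$ such that, for every graph $G$ on $n$ vertices and every $k\ge 0$, the program on input $(G,k)$ gives an output that iterative compression can give, hence decides whether $G$ has an OCT of size at most $k$, in at most $3^k\,p(n)$ steps. Thus Odd Cycle Transversal, parameterized by $k$, has an $O^*(3^k)$ FPT algorithm. In 3 and 5, programs are those of a WHILE language over binary trees in which each elementary operation (constructing a pair, taking a component, and so on) and each test counts as one step; graphs are given by adjacency matrices, vertex sets by characteristic vectors, and $k$ in unary. -/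

import Mathlib

/-! ### Odd cycle transversals and vertex covers -/

/-- `S` is an odd cycle transversal of `G`: the graph `G - S` is bipartite. -/
def IsOCT {V : Type*} (G : SimpleGraph V) (S : Finset V) : Prop :=
  (G.induce {v | v ∉ S}).IsBipartite

/-- The subgraph of `G` induced on the finite vertex set `A`. -/
def inducedOn {V : Type*} (G : SimpleGraph V) (A : Finset V) : SimpleGraph {v // v ∈ A} :=
  G.comap Subtype.val

/-- The part of `X` that lies in `A`, as a set of vertices of `inducedOn G A`. -/
def restrictTo {V : Type*} [DecidableEq V] (A X : Finset V) : Finset {v // v ∈ A} :=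
  X.subtype (· ∈ A)

/-- A set of vertices of `inducedOn G A`, as a set of vertices of `G`. -/
def liftFrom {V : Type*} {A : Finset V} (X : Finset {v // v ∈ A}) : Finset V :=
  X.map (Function.Embedding.subtype _)

/-- The graph `H²`: two copies `v₁ = (v, false)`, `v₂ = (v, true)` of each vertex `v`, a copy of `H`
on each of the two layers, and the edges `v₁ v₂`. -/
def doubleGraph {W : Type*} (H : SimpleGraph W) : SimpleGraph (W × Bool) where
  Adj x y := (H.Adj x.1 y.1 ∧ x.2 = y.2) ∨ (x.1 = y.1 ∧ x.2 ≠ y.2)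
  symm := ⟨fun _ _ h => h.imp (fun h => ⟨h.1.symm, h.2.symm⟩) (fun h => ⟨h.1.symm, h.2.symm⟩)⟩
  loopless := ⟨fun _ h => h.elim (fun h => h.1.ne rfl) (fun h => h.2 rfl)⟩

/-- `C` is a vertex cover of the induced subgraph `K[U]`. -/
def IsVertexCoverOn {α : Type*} (K : SimpleGraph α) (U C : Finset α) : Prop :=
  C ⊆ U ∧ (inducedOn K U).IsVertexCover {x | x.1 ∈ C}

/-- `C` is a vertex cover of `K[U]` of minimum cardinality. -/
def IsMinVertexCoverOn {α : Type*} (K : SimpleGraph α) (U C : Finset α) : Prop :=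
  IsVertexCoverOn K U C ∧ ∀ C', IsVertexCoverOn K U C' → C.card ≤ C'.card

/-! ### The disjoint compression algorithm

Algorithms with free choices (the order of an enumeration, which minimum vertex cover is found) are
described by the relation between their input, their possible outputs, and the number of iterations
of the innermost loop. An output `none` is the declaration that there is no solution. -/

section DisjointCompression

variable {W : Type*} [Fintype W] [DecidableEq W] (H : SimpleGraph W) (T : Finset W)

/-- The two layers `U₁ ∪ U₂` of a vertex set `U`. -/
def bothLayers (U : Finset W) : Finset (W × Bool) := U ×ˢ Finset.univ

/-- `Y ⊆ T₁ ∪ T₂` contains exactly one of `v₁`, `v₂` for each `v ∈ T`. -/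
def IsChoice (Y : Finset (W × Bool)) : Prop :=
  Y ⊆ bothLayers T ∧
    ∀ v ∈ T, ((v, false) ∈ Y ∧ (v, true) ∉ Y) ∨ ((v, false) ∉ Y ∧ (v, true) ∈ Y)

open Classical in
/-- The vertices of `B₁ ∪ B₂`, where `B = V(H) \ T`, adjacent in `H²` to a vertex of
`(T₁ ∪ T₂) \ Y`. -/
noncomputable def forced (Y : Finset (W × Bool)) : Finset (W × Bool) :=
  (bothLayers Tᶜ).filter fun x => ∃ y ∈ bothLayers T \ Y, (doubleGraph H).Adj x y

/-- The vertices `v` with both `v₁` and `v₂` in `X`. -/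
def doubled (X : Finset (W × Bool)) : Finset W :=
  Finset.univ.filter fun v => (v, false) ∈ X ∧ (v, true) ∈ X

/-- `T'` is a set that the body of the loop may compute from the choice `Y`. -/
def Candidate (Y : Finset (W × Bool)) (T' : Finset W) : Prop :=
  ∃ Z, IsMinVertexCoverOn (doubleGraph H) (bothLayers Tᶜ \ forced H T Y) Z ∧
    T' = doubled (Y ∪ forced H T Y ∪ Z)

/-- The loop of the disjoint compression algorithm, over a list of choices still to be tried: its
output and its number of iterations. The test `|T'| ≤ |T| - 1` is written `|T'| < |T|`. -/
inductive DisjointCompressionLoop :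
    List (Finset (W × Bool)) → Option (Finset W) → ℕ → Prop
  | done : DisjointCompressionLoop [] none 0
  | skip (Y : Finset (W × Bool)) (Ys : List (Finset (W × Bool))) (out : Option (Finset W)) (c : ℕ) :
      ¬ IsVertexCoverOn (doubleGraph H) (bothLayers T) Y →
      DisjointCompressionLoop Ys out c → DisjointCompressionLoop (Y :: Ys) out (c + 1)
  | found (Y : Finset (W × Bool)) (Ys : List (Finset (W × Bool))) (T' : Finset W) :
      IsVertexCoverOn (doubleGraph H) (bothLayers T) Y → Candidate H T Y T' →
      T'.card < T.card → DisjointCompressionLoop (Y :: Ys) (some T') 1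
  | tooLarge (Y : Finset (W × Bool)) (Ys : List (Finset (W × Bool))) (T' : Finset W)
      (out : Option (Finset W)) (c : ℕ) :
      IsVertexCoverOn (doubleGraph H) (bothLayers T) Y → Candidate H T Y T' →
      ¬ T'.card < T.card →
      DisjointCompressionLoop Ys out c → DisjointCompressionLoop (Y :: Ys) out (c + 1)

/-- The algorithm OCT-Disjoint-Compression on input `(H, T)` may output `out` after `c` iterations
of its loop. -/
def DisjointCompression (out : Option (Finset W)) (c : ℕ) : Prop :=
  ∃ Ys : List (Finset (W × Bool)), Ys.Nodup ∧ (∀ Y, Y ∈ Ys ↔ IsChoice T Y) ∧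
    DisjointCompressionLoop H T Ys out c

end DisjointCompression

/-! ### The compression step and iterative compression -/

section Compression

variable {V : Type*} [Fintype V] [DecidableEq V] (G : SimpleGraph V)

/-- Disjoint compression on `(H, T)`, where `T ⊆ S` and `H` is the subgraph of `G` induced on
`V(G) \ (S \ T)`; the output is read as a set of vertices of `G`, and `c` counts the iterations. -/
def DisjointCompressionIn (S T : Finset V) (out : Option (Finset V)) (c : ℕ) : Prop :=
  ∃ out', DisjointCompression (inducedOn G (S \ T)ᶜ) (restrictTo (S \ T)ᶜ T) out' c ∧
    out = out'.map liftFrom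

/-- The loop of the compression step over a list of subsets `T` of `S` still to be tried. -/
inductive CompressionLoop (S : Finset V) : List (Finset V) → Option (Finset V) → ℕ → Prop
  | done : CompressionLoop S [] none 0
  | found (T : Finset V) (Ts : List (Finset V)) (T' : Finset V) (c : ℕ) :
      DisjointCompressionIn G S T (some T') c →
      CompressionLoop S (T :: Ts) (some (T' ∪ (S \ T))) c
  | next (T : Finset V) (Ts : List (Finset V)) (out : Option (Finset V)) (c d : ℕ) :
      DisjointCompressionIn G S T none c → CompressionLoop S Ts out d →
      CompressionLoop S (T :: Ts) out (c + d)

/-- The compression step on `(G, S)` may output `out` after `c` iterations of the innermost loop in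
total. It tries every subset of `S` except the empty one, for which there is nothing to try: no set
has fewer than `0` elements. -/
def Compression (S : Finset V) (out : Option (Finset V)) (c : ℕ) : Prop :=
  ∃ Ts : List (Finset V), Ts.Nodup ∧ (∀ T, T ∈ Ts ↔ T ⊆ S ∧ T.Nonempty) ∧
    CompressionLoop G S Ts out c

/-- Iterative compression with bound `k`, over a list of vertices still to be added. Here `X` is the
current solution for the subgraph induced on the set `A` of vertices added so far. A new vertex is
added to the graph and to the solution; a solution of more than `k` vertices is then compressed, and
a failure of the compression step ends the process. -/
inductive IterativeCompressionLoop (k : ℕ) :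
    List V → Finset V → Finset V → Option (Finset V) → ℕ → Prop
  | done (A X : Finset V) : IterativeCompressionLoop k [] A X (some X) 0
  | grow (v : V) (vs : List V) (A X : Finset V) (out : Option (Finset V)) (c : ℕ) :
      (insert v X).card ≤ k →
      IterativeCompressionLoop k vs (insert v A) (insert v X) out c →
      IterativeCompressionLoop k (v :: vs) A X out c
  | compress (v : V) (vs : List V) (A X : Finset V) (X' : Finset {u // u ∈ insert v A})
      (out : Option (Finset V)) (c d : ℕ) :
      k < (insert v X).card →
      Compression (inducedOn G (insert v A)) (restrictTo (insert v A) (insert v X)) (some X') c →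
      IterativeCompressionLoop k vs (insert v A) (liftFrom X') out d →
      IterativeCompressionLoop k (v :: vs) A X out (c + d)
  | giveUp (v : V) (vs : List V) (A X : Finset V) (c : ℕ) :
      k < (insert v X).card →
      Compression (inducedOn G (insert v A)) (restrictTo (insert v A) (insert v X)) none c →
      IterativeCompressionLoop k (v :: vs) A X none c

/-- Iterative compression on `(G, k)` may output `out` after `c` iterations of the innermost loop in
total. -/
def IterativeCompression (k : ℕ) (out : Option (Finset V)) (c : ℕ) : Prop :=
  ∃ vs : List V, vs.Nodup ∧ (∀ v, v ∈ vs) ∧ IterativeCompressionLoop G k vs ∅ ∅ out c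

end Compression

/-- The number `∑_{i=1}^{k+1} C(k+1, i) 2^i`. -/
def compressionCost (k : ℕ) : ℕ := ∑ i ∈ Finset.Icc 1 (k + 1), (k + 1).choose i * 2 ^ i

/-! ### The machine model

Programs of a WHILE language over binary trees (the data type of pure LISP). A tree is held by a
pointer to an immutable cell, so that each elementary operation below is a constant number of
operations of a random access machine whose addresses have logarithmic length. -/

/-- Binary trees. -/
inductive Val where
  | nil : Val
  | cons : Val → Val → Val

/-- The first component of a tree (`nil` if there is none). -/
def Val.head : Val → Val
  | .nil => .nil
  | .cons x _ => x

/-- The second component of a tree (`nil` if there is none). -/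
def Val.tail : Val → Val
  | .nil => .nil
  | .cons _ y => y

/-- Programs, each transforming one tree into another: constants, projections, pairing,
composition (`seq p q` runs `p` first), a conditional, and a while loop
(`loop b p` is: while the value of `b` is not `nil`, apply `p`). -/
inductive Prog where
  | skip : Prog
  | nil : Prog
  | head : Prog
  | tail : Prog
  | cons : Prog → Prog → Prog
  | seq : Prog → Prog → Prog
  | ite : Prog → Prog → Prog → Prog
  | loop : Prog → Prog → Prog

/-- `Run p x y t`: on input `x`, the program `p` halts with output `y` after exactly `t` steps.
Every elementary operation and every test is one step. -/
inductive Run : Prog → Val → Val → ℕ → Prop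
  | skip (x : Val) : Run .skip x x 1
  | nil (x : Val) : Run .nil x .nil 1
  | head (x : Val) : Run .head x x.head 1
  | tail (x : Val) : Run .tail x x.tail 1
  | cons {p q : Prog} {x y z : Val} {s t : ℕ} :
      Run p x y s → Run q x z t → Run (.cons p q) x (.cons y z) (s + t + 1)
  | seq {p q : Prog} {x y z : Val} {s t : ℕ} :
      Run p x y s → Run q y z t → Run (.seq p q) x z (s + t + 1)
  | iteTrue {b p q : Prog} {x u v y : Val} {s t : ℕ} :
      Run b x (.cons u v) s → Run p x y t → Run (.ite b p q) x y (s + t + 1)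
  | iteFalse {b p q : Prog} {x y : Val} {s t : ℕ} :
      Run b x .nil s → Run q x y t → Run (.ite b p q) x y (s + t + 1)
  | loopDone {b p : Prog} {x : Val} {s : ℕ} :
      Run b x .nil s → Run (.loop b p) x x (s + 1)
  | loopStep {b p : Prog} {x u v y z : Val} {s t r : ℕ} :
      Run b x (.cons u v) s → Run p x y t → Run (.loop b p) y z r →
      Run (.loop b p) x z (s + t + r + 1)

/-- The machine is deterministic: the output and the number of steps depend only on the input. -/
theorem Run.deterministic {p : Prog} {x y y' : Val} {t t' : ℕ} (h : Run p x y t)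
    (h' : Run p x y' t') : y = y' ∧ t = t' := by
  induction h generalizing y' t' with
  | skip => cases h'; exact ⟨rfl, rfl⟩
  | nil => cases h'; exact ⟨rfl, rfl⟩
  | head => cases h'; exact ⟨rfl, rfl⟩
  | tail => cases h'; exact ⟨rfl, rfl⟩
  | cons _ _ ih₁ ih₂ =>
    cases h' with
    | cons a b => obtain ⟨rfl, rfl⟩ := ih₁ a; obtain ⟨rfl, rfl⟩ := ih₂ b; exact ⟨rfl, rfl⟩
  | seq _ _ ih₁ ih₂ =>
    cases h' with
    | seq a b => obtain ⟨rfl, rfl⟩ := ih₁ a; obtain ⟨rfl, rfl⟩ := ih₂ b; exact ⟨rfl, rfl⟩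
  | iteTrue _ _ ih₁ ih₂ =>
    cases h' with
    | iteTrue a b => obtain ⟨-, rfl⟩ := ih₁ a; obtain ⟨rfl, rfl⟩ := ih₂ b; exact ⟨rfl, rfl⟩
    | iteFalse a b => exact absurd (ih₁ a).1 (by simp)
  | iteFalse _ _ ih₁ ih₂ =>
    cases h' with
    | iteTrue a b => exact absurd (ih₁ a).1 (by simp)
    | iteFalse a b => obtain ⟨-, rfl⟩ := ih₁ a; obtain ⟨rfl, rfl⟩ := ih₂ b; exact ⟨rfl, rfl⟩
  | loopDone _ ih =>
    cases h' with
    | loopDone a => obtain ⟨-, rfl⟩ := ih a; exact ⟨rfl, rfl⟩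
    | loopStep a b c => exact absurd (ih a).1 (by simp)
  | loopStep _ _ _ ih₁ ih₂ ih₃ =>
    cases h' with
    | loopDone a => exact absurd (ih₁ a).1 (by simp)
    | loopStep a b c =>
      obtain ⟨-, rfl⟩ := ih₁ a
      obtain ⟨rfl, rfl⟩ := ih₂ b
      obtain ⟨rfl, rfl⟩ := ih₃ c
      exact ⟨rfl, rfl⟩

/-! ### Encodings of inputs and outputs -/

/-- The truth values: `false` is `nil`. -/
def encodeBool : Bool → Val
  | false => .nil
  | true => .cons .nil .nil

/-- A list of trees as a tree. -/
def encodeList : List Val → Val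
  | [] => .nil
  | x :: xs => .cons x (encodeList xs)

/-- A natural number in unary. -/
def encodeNat (n : ℕ) : Val := encodeList (List.replicate n .nil)

/-- A set of vertices as its characteristic vector. -/
def encodeSet {n : ℕ} (S : Finset (Fin n)) : Val :=
  encodeList (List.ofFn fun i => encodeBool (decide (i ∈ S)))

open Classical in
/-- A graph as the list of the rows of its adjacency matrix. -/
noncomputable def encodeGraph {n : ℕ} (G : SimpleGraph (Fin n)) : Val :=
  encodeList (List.ofFn fun i => encodeList (List.ofFn fun j => encodeBool (decide (G.Adj i j))))

/-- A set of vertices (the answer "yes", with a solution) or the answer "no", which is `nil`. -/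
def encodeOutput {n : ℕ} : Option (Finset (Fin n)) → Val
  | none => .nil
  | some X => .cons .nil (encodeSet X)

/-! Correctness rests on vertex covers of `H²`. A cover `X` contains a copy of every vertex, so `|X|
= |V(H)| + |T'|`, where `T'` is the set of vertices with both copies in `X`
(`card_eq_card_add_card_doubled`). Off `T'`, the one uncovered copy of each vertex gives a proper
2-colouring, so `T'` is a transversal (`Candidate.isOCT`). Conversely, let `X'` be a transversal of
`H` disjoint from `T`, with a colouring `c` of `H - X'`. Leaving out exactly the copies `(v, c v)`
with `v ∉ X'` gives a cover of `H²` that doubles `X'`, contains the choice `Y = choiceOf T c` and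
contains everything that `Y` forces. Only `Z` is free, so a minimum `Z` yields `|T'| ≤ |X'|`
(`card_candidate_le`).

If `X` is a transversal of `G` smaller than `S`, the run for `T = S \ X` must succeed, because `X \
S` is a transversal of `H` disjoint from `T` and smaller than `T`. Each `T` has `2 ^ |T|` choices,
and the binomial theorem sums these to `3 ^ |S| - 1` over nonempty `T`. Iterative compression calls
the step only on solutions with exactly `k + 1` vertices, and a failure is final because
transversals restrict to induced subgraphs.

The programs do not follow the two nested loops literally. They run through the `3 ^ |S|` partial
colourings of `S`: the coloured vertices form `T`, the colours give `Y`, and the uncoloured vertices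
are deleted. For each one a minimum vertex cover completes the set to be deleted, and the smallest
set found is kept. The result is a minimum transversal (`bestTransversal_spec`). This is legitimate
because every minimum transversal smaller than `S` is a possible output of the compression step, for
suitable orders and covers (`Compression.of_minimum`), and failure is possible when none is smaller.

A 2-colouring `φ` of `G - S` makes the graph to be covered bipartite: the copies `(v, φ v)` against
the copies `(v, !φ v)`. A minimum cover is found by an auction. Final owners form a matching, and a
price level that nobody pays separates out a cover of the same size, as in König's theorem
(`auction_isCover`, `auction_cover_le`). Running times come from the closure properties of
`Feasible`: time `τ` up to a polynomial in the number of vertices. -/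

/-! ### Programs with time bounds -/

/-- On input `x`, the program `P` halts with output `y` after at most `T` steps. -/
def RunsWithin (P : Prog) (x y : Val) (T : ℕ) : Prop := ∃ t ≤ T, Run P x y t

theorem RunsWithin.mono {P : Prog} {x y : Val} {S T : ℕ} (h : RunsWithin P x y S) (hST : S ≤ T) :
    RunsWithin P x y T :=
  let ⟨t, ht, hr⟩ := h
  ⟨t, ht.trans hST, hr⟩

theorem Run.within {P : Prog} {x y : Val} {t : ℕ} (h : Run P x y t) : RunsWithin P x y t :=
  ⟨t, le_rfl, h⟩

theorem RunsWithin.cons {p q : Prog} {x y z : Val} {s t : ℕ} (hp : RunsWithin p x y s)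
    (hq : RunsWithin q x z t) : RunsWithin (.cons p q) x (.cons y z) (s + t + 1) :=
  let ⟨_, h₁, r₁⟩ := hp
  let ⟨_, h₂, r₂⟩ := hq
  ⟨_, by omega, .cons r₁ r₂⟩

theorem RunsWithin.seq {p q : Prog} {x y z : Val} {s t : ℕ} (hp : RunsWithin p x y s)
    (hq : RunsWithin q y z t) : RunsWithin (.seq p q) x z (s + t + 1) :=
  let ⟨_, h₁, r₁⟩ := hp
  let ⟨_, h₂, r₂⟩ := hq
  ⟨_, by omega, .seq r₁ r₂⟩

/-- Repeats the program `Q` for each number below a counter, in decreasing order. The state consists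
of the counter, an accumulator, and a constant context; `Q` computes the new accumulator. -/
def Prog.countdown (Q : Prog) : Prog :=
  .loop .head (.seq (.cons (.seq .head .tail) .tail) (.cons .head (.cons Q (.seq .tail .tail))))

/-- `Q` sees the counter already decreased, so the accumulator goes from `acc n` down to `acc 0`.
This is the order of a right fold over `List.finRange n`, which treats the last vertex first. -/
theorem RunsWithin.countdown {Q : Prog} {c : Val} {acc : ℕ → Val} {T : ℕ} (n : ℕ)
    (h : ∀ j < n, RunsWithin Q (.cons (encodeNat j) (.cons (acc (j + 1)) c)) (acc j) T) :
    RunsWithin Q.countdown (.cons (encodeNat n) (.cons (acc n) c)) (.cons .nil (.cons (acc 0) c))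
      (n * (T + 20) + 2) := by
  induction n with
  | zero => exact ⟨2, by omega, .loopDone (.head _)⟩
  | succ n ih =>
    obtain ⟨t, ht, hr⟩ := h n n.lt_succ_self
    obtain ⟨s, hs, hq⟩ := ih fun j hj => h j (by omega)
    refine ⟨_, ?_, .loopStep (.head _) (.seq (.cons (.seq (.head _) (.tail _)) (.tail _))
      (.cons (.head _) (.cons hr (.seq (.tail _) (.tail _))))) hq⟩
    rw [Nat.add_mul]
    omega

/-- Repeats the program `Q` for each member of a list. The state consists of the list, an
accumulator, and a constant context; `Q` computes the new accumulator. -/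
def Prog.forEach (Q : Prog) : Prog :=
  .loop .head (.cons (.seq .head .tail)
    (.cons (.seq (.cons (.seq .head .head) .tail) Q) (.seq .tail .tail)))

theorem RunsWithin.forEach {β : Type*} {Q : Prog} {c : Val} {γ : Type*} {enc : β → Val}
    {encAcc : γ → Val} {f : γ → β → γ} {T : ℕ}
    (h : ∀ b s, RunsWithin Q (.cons (enc b) (.cons (encAcc s) c)) (encAcc (f s b)) T) (l : List β)
    (s : γ) :
    RunsWithin Q.forEach (.cons (encodeList (l.map enc)) (.cons (encAcc s) c))
      (.cons .nil (.cons (encAcc (l.foldl f s)) c)) (l.length * (T + 20) + 2) := by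
  induction l generalizing s with
  | nil => exact ⟨2, by omega, .loopDone (.head _)⟩
  | cons b l ih =>
    obtain ⟨t, ht, hr⟩ := h b s
    obtain ⟨t', ht', hr'⟩ := ih (f s b)
    refine ⟨_, ?_, .loopStep (.head _) (.cons (.seq (.head _) (.tail _)) (.cons (.seq (.cons
      (.seq (.head _) (.head _)) (.tail _)) hr) (.seq (.tail _) (.tail _)))) hr'⟩
    rw [List.length_cons, Nat.add_mul]
    omega

/-- Compares two numbers in unary. -/
theorem exists_prog_le : ∃ P : Prog, ∀ a b : ℕ,
    RunsWithin P (.cons (encodeNat a) (encodeNat b)) (encodeBool (decide (a ≤ b))) (20 * (a + 1)) := by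
  -- The test `.ite .head .tail .nil` is a conjunction: one unit is removed from each number until
  -- one of them is used up, leaving both truncated differences.
  have key : ∀ a b : ℕ, RunsWithin
      (.loop (.ite .head .tail .nil) (.cons (.seq .head .tail) (.seq .tail .tail)))
      (.cons (encodeNat a) (encodeNat b)) (.cons (encodeNat (a - b)) (encodeNat (b - a)))
      (15 * a + 5) := by
    intro a
    induction a with
    | zero =>
      intro b
      rw [Nat.zero_sub, Nat.sub_zero]
      exact ⟨_, by omega, .loopDone (.iteFalse (.head _) (.nil _))⟩
    | succ a ih =>
      rintro (_ | b)
      · rw [Nat.zero_sub, Nat.sub_zero]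
        exact ⟨_, by omega, .loopDone (.iteTrue (.head _) (.tail _))⟩
      · obtain ⟨t, ht, hr⟩ := ih b
        rw [Nat.add_sub_add_right, Nat.add_sub_add_right]
        exact (Run.loopStep (.iteTrue (.head _) (.tail _))
          (.cons (.seq (.head _) (.tail _)) (.seq (.tail _) (.tail _))) hr).within.mono (by omega)
  refine ⟨.seq (.loop (.ite .head .tail .nil) (.cons (.seq .head .tail) (.seq .tail .tail)))
    (.ite .head .nil (.cons .nil .nil)), fun a b => ?_⟩
  refine ((key a b).seq (t := 6) ?_).mono (by omega)
  by_cases hab : a ≤ b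
  · rw [Nat.sub_eq_zero_of_le hab, decide_eq_true hab]
    exact ⟨_, by omega, .iteFalse (.head _) (.cons (.nil _) (.nil _))⟩
  · obtain ⟨d, hd⟩ : ∃ d, a - b = d + 1 := ⟨a - b - 1, by omega⟩
    rw [hd, decide_eq_false hab]
    exact ⟨_, by omega, .iteTrue (.head _) (.nil _)⟩

/-- Finds the member of a list at a given position. -/
theorem exists_prog_getElem : ∃ P : Prog, ∀ (l : List Val) (i : ℕ) (hi : i < l.length),
    RunsWithin P (.cons (encodeNat i) (encodeList l)) l[i] (20 * (i + 1)) := by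
  have key : ∀ (i : ℕ) (l : List Val), i < l.length → RunsWithin
      (.loop .head (.cons (.seq .head .tail) (.seq .tail .tail)))
      (.cons (encodeNat i) (encodeList l)) (.cons .nil (encodeList (l.drop i))) (15 * i + 5) := by
    intro i
    induction i with
    | zero => exact fun l _ => ⟨_, by omega, .loopDone (.head _)⟩
    | succ i ih =>
      rintro (_ | ⟨x, l⟩) hi
      · simp at hi
      · obtain ⟨t, ht, hr⟩ := ih l (by simpa using hi)
        exact ⟨_, by omega, .loopStep (.head _)
          (.cons (.seq (.head _) (.tail _)) (.seq (.tail _) (.tail _))) hr⟩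
  refine ⟨.seq (.loop .head (.cons (.seq .head .tail) (.seq .tail .tail))) (.seq .tail .head),
    fun l i hi => ?_⟩
  refine ((key i l hi).seq (t := 3) ?_).mono (by omega)
  rw [List.drop_eq_getElem_cons hi]
  exact ⟨_, by omega, .seq (.tail _) (.head _)⟩

/-- Computes the length of a list. -/
theorem exists_prog_length : ∃ P : Prog, ∀ l : List Val,
    RunsWithin P (encodeList l) (encodeNat l.length) (50 * (l.length + 1)) := by
  refine ⟨.seq (.seq (.cons .skip (.cons .nil .nil))
    (Prog.forEach (.cons .nil (.seq .tail .head)))) (.seq .tail .head), fun l => ?_⟩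
  have h := RunsWithin.forEach (Q := .cons .nil (.seq .tail .head)) (c := .nil) (enc := id)
    (encAcc := encodeNat) (f := fun s _ => s + 1) (T := 5)
    (fun b s => ⟨_, by omega, .cons (.nil _) (.seq (.tail _) (.head _))⟩) l 0
  have h0 : l.foldl (fun s _ => s + 1) 0 = l.length := by simp
  rw [h0, List.map_id] at h
  refine ((RunsWithin.seq (s := 5) ?_ h).seq (t := 3) ?_).mono (by omega)
  · exact ⟨_, by omega, .cons (.skip _) (.cons (.nil _) (.nil _))⟩
  · exact ⟨_, by omega, .seq (.tail _) (.head _)⟩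

/-! ### Coded families of types -/

/-- A family of types, indexed by the order of a graph, with codes for its members. -/
class Code (α : ℕ → Type) where
  code : ∀ {n : ℕ}, α n → Val

open Code (code)

instance : Code (fun _ => Bool) := ⟨encodeBool⟩
instance : Code (fun _ => ℕ) := ⟨encodeNat⟩
instance : Code (fun n => Fin n) := ⟨fun i => encodeNat i⟩

instance {α β : ℕ → Type} [Code α] [Code β] : Code (fun n => α n × β n) :=
  ⟨fun x => .cons (code x.1) (code x.2)⟩

instance {β : ℕ → Type} [Code β] : Code (fun n => Fin n → β n) :=
  ⟨fun f => encodeList (List.ofFn fun i => code (f i))⟩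

instance {β : ℕ → Type} [Code β] : Code (fun n => List (β n)) :=
  ⟨fun l => encodeList (l.map code)⟩

instance {β : ℕ → Type} [Code β] : Code (fun n => Option (β n)) :=
  ⟨fun o => o.elim .nil fun b => .cons .nil (code b)⟩

/-- Numbers that can be at most `n + 1`. -/
structure Level (n : ℕ) where
  val : ℕ
  lt : val < n + 2

instance : Code Level := ⟨fun x => encodeNat x.val⟩

/-- The function `f` is computed, uniformly in `n`, in time `τ` up to a polynomial in `n`. -/
def Feasible {α β : ℕ → Type} [Code α] [Code β] (τ : ∀ n, α n → ℕ) (f : ∀ n, α n → β n) :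
    Prop :=
  ∃ (P : Prog) (p : Polynomial ℕ), ∀ n (a : α n),
    RunsWithin P (.cons (encodeNat n) (code a)) (code (f n a)) ((τ n a + 1) * p.eval n)

namespace Feasible

variable {α β γ δ : ℕ → Type} [Code α] [Code β] [Code γ] [Code δ] {τ : ∀ n, α n → ℕ}

theorem of_runsWithin {f : ∀ n, α n → β n} (P : Prog) (p : Polynomial ℕ)
    (h : ∀ n (a : α n), RunsWithin P (.cons (encodeNat n) (code a)) (code (f n a)) (p.eval n)) :
    Feasible τ f :=
  ⟨P, p, fun n a => (h n a).mono (Nat.le_mul_of_pos_left _ (Nat.succ_pos _))⟩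

/-- Programs see only codes. Numbers, vertices and levels share their codes, as do functions and
their lists of values, so passing between these types is free. -/
theorem of_code_eq {f : ∀ n, α n → β n} {g : ∀ n, α n → γ n} (hf : Feasible τ f)
    (h : ∀ n a, code (f n a) = code (g n a)) : Feasible τ g :=
  let ⟨P, p, hP⟩ := hf
  ⟨P, p, fun n a => h n a ▸ hP n a⟩

theorem comp {τ' : ∀ n, β n → ℕ} {g : ∀ n, β n → γ n} {f : ∀ n, α n → β n}
    (hg : Feasible τ' g) (hf : Feasible τ f) (h : ∀ n a, τ' n (f n a) ≤ τ n a) :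
    Feasible τ (fun n a => g n (f n a)) := by
  obtain ⟨P, p, hP⟩ := hf
  obtain ⟨Q, q, hQ⟩ := hg
  refine ⟨.seq (.cons .head P) Q, p + q + 3, fun n a => ?_⟩
  refine (((Run.head _).within.cons (hP n a)).seq (hQ n (f n a))).mono ?_
  have := Nat.mul_le_mul_right (q.eval n) (Nat.succ_le_succ (h n a))
  simp only [Polynomial.eval_add, Polynomial.eval_ofNat]
  nlinarith

/-- Composition with a function that is computed in polynomial time. -/
theorem comp₀ {g : ∀ n, β n → γ n} {f : ∀ n, α n → β n}
    (hg : Feasible (fun _ _ => 0) g) (hf : Feasible τ f) :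
    Feasible τ (fun n a => g n (f n a)) :=
  hg.comp hf fun _ _ => Nat.zero_le _

theorem mono {τ' : ∀ n, α n → ℕ} {f : ∀ n, α n → β n} (hf : Feasible τ' f)
    (h : ∀ n a, τ' n a ≤ τ n a) : Feasible τ f :=
  let ⟨P, p, hP⟩ := hf
  ⟨P, p, fun n a => (hP n a).mono (Nat.mul_le_mul_right _ (Nat.succ_le_succ (h n a)))⟩

theorem of_poly {f : ∀ n, α n → β n} (hf : Feasible (fun _ _ => 0) f) : Feasible τ f :=
  hf.mono fun _ _ => Nat.zero_le _

/-- The argument acts as a context of variables, a nested pair extended on the right; chains such as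
`var.fst.snd` are de Bruijn indices. -/
theorem var : Feasible τ (fun _ a => a) :=
  of_runsWithin .tail 1 fun n a => (Run.tail _).within.mono (by simp)

theorem fst {f : ∀ n, α n → β n × γ n} (hf : Feasible τ f) :
    Feasible τ (fun n a => (f n a).1) :=
  comp₀ (g := fun n (x : β n × γ n) => x.1) (of_runsWithin (.seq .tail .head) 3 fun n a =>
    (Run.seq (.tail _) (.head _)).within.mono (by simp)) hf

theorem snd {f : ∀ n, α n → β n × γ n} (hf : Feasible τ f) :
    Feasible τ (fun n a => (f n a).2) :=
  comp₀ (g := fun n (x : β n × γ n) => x.2) (of_runsWithin (.seq .tail .tail) 3 fun n a =>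
    (Run.seq (.tail _) (.tail _)).within.mono (by simp)) hf

/-- The last variable of a context. -/
theorem last {τ : ∀ n, α n × β n → ℕ} : Feasible τ (fun _ x => x.2) := var.snd

/-- Weakening: a context is extended by a variable. -/
theorem wk {f : ∀ n, α n → β n} (hf : Feasible τ f) :
    Feasible (fun n (x : α n × γ n) => τ n x.1) (fun n x => f n x.1) :=
  hf.comp var.fst fun _ _ => le_rfl

theorem pair {f : ∀ n, α n → β n} {g : ∀ n, α n → γ n} (hf : Feasible τ f)
    (hg : Feasible τ g) : Feasible τ (fun n a => (f n a, g n a)) := by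
  obtain ⟨P, p, hP⟩ := hf
  obtain ⟨Q, q, hQ⟩ := hg
  refine ⟨.cons P Q, p + q + 1, fun n a => ((hP n a).cons (hQ n a)).mono ?_⟩
  simp only [Polynomial.eval_add, Polynomial.eval_one]
  nlinarith

/-- A conditional; the bounds for the two branches need only hold where the branches are taken. -/
theorem ite' {τ₁ τ₂ : ∀ n, α n → ℕ} {c : ∀ n, α n → Bool} {f g : ∀ n, α n → β n}
    (hc : Feasible τ c) (hf : Feasible τ₁ f) (hg : Feasible τ₂ g)
    (h₁ : ∀ n a, c n a = true → τ₁ n a ≤ τ n a) (h₂ : ∀ n a, c n a = false → τ₂ n a ≤ τ n a) :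
    Feasible τ (fun n a => if c n a = true then f n a else g n a) := by
  obtain ⟨C, r, hC⟩ := hc
  obtain ⟨P, p, hP⟩ := hf
  obtain ⟨Q, q, hQ⟩ := hg
  refine ⟨.ite C P Q, r + p + q + 1, fun n a => ?_⟩
  simp only [Polynomial.eval_add, Polynomial.eval_one]
  obtain ⟨s, hs, hr⟩ := hC n a
  cases hca : c n a with
  | true =>
    obtain ⟨t, ht, hr'⟩ := hP n a
    have := Nat.mul_le_mul_right (p.eval n) (Nat.succ_le_succ (h₁ n a hca))
    rw [hca] at hr
    refine ⟨_, ?_, .iteTrue hr (by simpa using hr')⟩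
    nlinarith [Nat.zero_le ((τ n a + 1) * q.eval n)]
  | false =>
    obtain ⟨t, ht, hr'⟩ := hQ n a
    have := Nat.mul_le_mul_right (q.eval n) (Nat.succ_le_succ (h₂ n a hca))
    rw [hca] at hr
    refine ⟨_, ?_, .iteFalse hr (by simpa using hr')⟩
    nlinarith [Nat.zero_le ((τ n a + 1) * p.eval n)]

theorem ite {c : ∀ n, α n → Bool} {f g : ∀ n, α n → β n}
    (hc : Feasible τ c) (hf : Feasible τ f) (hg : Feasible τ g) :
    Feasible τ (fun n a => if c n a = true then f n a else g n a) :=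
  ite' hc hf hg (fun _ _ _ => le_rfl) fun _ _ _ => le_rfl

/-! Truth values -/

theorem true : Feasible τ (fun _ _ => true) :=
  of_runsWithin (.cons .nil .nil) 3 fun _ _ => (Run.cons (.nil _) (.nil _)).within.mono (by simp)

theorem false : Feasible τ (fun _ _ => false) :=
  of_runsWithin .nil 1 fun _ _ => (Run.nil _).within.mono (by simp)

theorem not {f : ∀ n, α n → Bool} (hf : Feasible τ f) : Feasible τ (fun n a => !f n a) :=
  (ite hf false true).of_code_eq fun n a => by cases f n a <;> rfl

theorem and {f g : ∀ n, α n → Bool} (hf : Feasible τ f) (hg : Feasible τ g) :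
    Feasible τ (fun n a => f n a && g n a) :=
  (ite hf hg false).of_code_eq fun n a => by cases f n a <;> rfl

theorem or {f g : ∀ n, α n → Bool} (hf : Feasible τ f) (hg : Feasible τ g) :
    Feasible τ (fun n a => f n a || g n a) :=
  (ite hf true hg).of_code_eq fun n a => by cases f n a <;> rfl

theorem beq {f g : ∀ n, α n → Bool} (hf : Feasible τ f) (hg : Feasible τ g) :
    Feasible τ (fun n a => f n a == g n a) :=
  (ite hf hg hg.not).of_code_eq fun n a => by cases f n a <;> cases g n a <;> rfl

/-! Options -/

theorem none : Feasible τ (fun n _ => (none : Option (β n))) :=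
  of_runsWithin .nil 1 fun _ _ => (Run.nil _).within.mono (by simp)

theorem some {f : ∀ n, α n → β n} (hf : Feasible τ f) :
    Feasible τ (fun n a => some (f n a)) :=
  comp₀ (g := fun n (x : β n) => Option.some x) (of_runsWithin (.cons .nil .tail) 3 fun n a =>
    (Run.cons (.nil _) (.tail _)).within.mono (by simp)) hf

theorem isSome {f : ∀ n, α n → Option (β n)} (hf : Feasible τ f) :
    Feasible τ (fun n a => (f n a).isSome) := by
  refine comp₀ (g := fun n (x : Option (β n)) => x.isSome)
    (of_runsWithin (.ite .tail (.cons .nil .nil) .nil) 5 fun n a => ?_) hf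
  cases a with
  | none => exact (Run.iteFalse (.tail _) (.nil _)).within.mono (by simp)
  | some a => exact (Run.iteTrue (.tail _) (.cons (.nil _) (.nil _))).within.mono (by simp)

theorem getD {f : ∀ n, α n → Option (β n)} {g : ∀ n, α n → β n} (hf : Feasible τ f)
    (hg : Feasible τ g) : Feasible τ (fun n a => (f n a).getD (g n a)) := by
  refine comp₀ (g := fun n (x : Option (β n) × β n) => x.1.getD x.2)
    (of_runsWithin (.seq .tail (.ite .head (.seq .head .tail) .tail)) 8 fun n a => ?_)
    (hf.pair hg)
  obtain ⟨_ | a, b⟩ := a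
  · exact (Run.seq (.tail _) (.iteFalse (.head _) (.tail _))).within.mono (by simp)
  · exact (Run.seq (.tail _) (.iteTrue (.head _) (.seq (.head _) (.tail _)))).within.mono (by simp)

/-! Numbers -/

/-- The comparison stops as soon as one number is exhausted, so a bound on the left one suffices;
the parameter `k` on the right may be arbitrarily large. -/
theorem le {f g : ∀ n, α n → ℕ} (hf : Feasible τ f) (hg : Feasible τ g)
    (h : ∀ n a, f n a ≤ n + 1) : Feasible τ (fun n a => decide (f n a ≤ g n a)) := by
  obtain ⟨P, hP⟩ := exists_prog_le
  obtain ⟨Q, q, hQ⟩ := hf.pair hg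
  refine ⟨.seq Q P, q + 20 * .X + 41, fun n a => ((hQ n a).seq (hP _ _)).mono ?_⟩
  have := h n a
  simp only [Polynomial.eval_add, Polynomial.eval_mul, Polynomial.eval_ofNat, Polynomial.eval_X]
  nlinarith [Nat.zero_le (τ n a * (20 * n + 41))]

theorem eq {f g : ∀ n, α n → ℕ} (hf : Feasible τ f) (hg : Feasible τ g)
    (h : ∀ n a, f n a ≤ n + 1) (h' : ∀ n a, g n a ≤ n + 1) :
    Feasible τ (fun n a => decide (f n a = g n a)) :=
  ((hf.le hg h).and (hg.le hf h')).of_code_eq fun n a => by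
    rw [← Bool.decide_and, decide_eq_decide.2 (Nat.le_antisymm_iff (a := f n a)).symm]

theorem succ {f : ∀ n, α n → ℕ} (hf : Feasible τ f) : Feasible τ (fun n a => f n a + 1) :=
  comp₀ (g := fun _ (x : ℕ) => x + 1) (of_runsWithin (.cons .nil .tail) 3 fun n a =>
    (Run.cons (.nil _) (.tail _)).within.mono (by simp)) hf

theorem zero : Feasible τ (fun _ _ => 0) :=
  of_runsWithin .nil 1 fun _ _ => (Run.nil _).within.mono (by simp)

theorem order : Feasible τ (fun n _ => n) :=
  of_runsWithin .head 1 fun _ _ => (Run.head _).within.mono (by simp)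

theorem levelVal {f : ∀ n, α n → Level n} (hf : Feasible τ f) :
    Feasible τ (fun n a => (f n a).val) :=
  hf.of_code_eq fun _ _ => rfl

theorem finVal {f : ∀ n, α n → Fin n} (hf : Feasible τ f) :
    Feasible τ (fun n a => (f n a).val) :=
  hf.of_code_eq fun _ _ => rfl

theorem toLevel {f : ∀ n, α n → ℕ} (hf : Feasible τ f) (h : ∀ n a, f n a < n + 2) :
    Feasible τ (fun n a => (⟨f n a, h n a⟩ : Level n)) :=
  hf.of_code_eq fun _ _ => rfl

theorem finBeq {f g : ∀ n, α n → Fin n} (hf : Feasible τ f) (hg : Feasible τ g) :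
    Feasible τ (fun n a => f n a == g n a) :=
  (hf.finVal.eq hg.finVal (fun _ _ => by omega) (fun _ _ => by omega)).of_code_eq fun n a => by
    simp only [Fin.val_inj]; congr 1

/-! Functions on vertices -/

theorem app {f : ∀ n, α n → Fin n → β n} {i : ∀ n, α n → Fin n} (hf : Feasible τ f)
    (hi : Feasible τ i) : Feasible τ (fun n a => f n a (i n a)) := by
  obtain ⟨P, hP⟩ := exists_prog_getElem
  obtain ⟨Q, q, hQ⟩ := hi.pair hf
  refine ⟨.seq Q P, q + 20 * .X + 41, fun n a => ((hQ n a).seq (y := _)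
    (t := 20 * (n + 1)) ?_).mono ?_⟩
  · have h := hP (List.ofFn fun j => code (f n a j)) (i n a) (by simp)
    rw [List.getElem_ofFn] at h
    exact h.mono (by have := (i n a).2; omega)
  · simp only [Polynomial.eval_add, Polynomial.eval_mul, Polynomial.eval_ofNat, Polynomial.eval_X]
    nlinarith [Nat.zero_le (τ n a * (20 * n + 41))]

/-- The cost of the body need only be bounded at accumulators that occur, namely the folds over
suffixes. This matters when the accumulator grows exponentially, as the list of partial colourings
does. -/
theorem foldr {τ' : ∀ n, (α n × Fin n) × γ n → ℕ} {f : ∀ n, α n → Fin n → γ n → γ n}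
    {s : ∀ n, α n → γ n} (hf : Feasible τ' (fun n x => f n x.1.1 x.1.2 x.2))
    (hs : Feasible τ s)
    (h : ∀ n a i (l : List (Fin n)), l <:+ List.finRange n →
      τ' n ((a, i), l.foldr (f n a) (s n a)) ≤ τ n a) :
    Feasible τ (fun n a => (List.finRange n).foldr (f n a) (s n a)) := by
  obtain ⟨P, p, hP⟩ := hs
  obtain ⟨Q, q, hQ⟩ := hf
  -- The body of the loop sees `(j, (acc, (n, a)))`; `N` and `A` extract `n` and `a`, to assemble
  -- the input `(n, ((a, j), acc))` of `Q`.
  let N : Prog := .seq .tail (.seq .tail .head)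
  let A : Prog := .seq .tail (.seq .tail .tail)
  refine ⟨.seq (.cons .head (.cons P .skip))
    (.seq (Prog.countdown (.seq (.cons N (.cons (.cons A .head) (.seq .tail .head))) Q))
      (.seq .tail .head)), p + .X * (q + 50) + 20, fun n a => ?_⟩
  let acc : ℕ → Val := fun j => code (((List.finRange n).drop j).foldr (f n a) (s n a))
  have hn : acc n = code (s n a) := by
    simp only [acc, List.drop_eq_nil_of_le (List.length_finRange (n := n)).le, List.foldr_nil]
  have h0 : acc 0 = code ((List.finRange n).foldr (f n a) (s n a)) := by simp [acc]
  have hrun := RunsWithin.countdown (Q := (.seq (.cons N (.cons (.cons A .head) (.seq .tail .head))) Q))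
    (c := .cons (encodeNat n) (code a)) (acc := acc) (T := (τ n a + 1) * q.eval n + 20) n
    fun j hj => ?_
  · rw [hn, h0] at hrun
    refine ((((Run.head _).within.cons ((hP n a).cons (Run.skip _).within))).seq
      (hrun.seq (Run.seq (.tail _) (.head _)).within)).mono ?_
    simp only [Polynomial.eval_add, Polynomial.eval_mul, Polynomial.eval_ofNat, Polynomial.eval_X]
    nlinarith [Nat.zero_le (τ n a * (n * 50 + 20))]
  · have hd : (List.finRange n).drop j = ⟨j, hj⟩ :: (List.finRange n).drop (j + 1) := by
      rw [List.drop_eq_getElem_cons (by simpa using hj)]; simp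
    have hj' : acc j = code (f n a ⟨j, hj⟩ (((List.finRange n).drop (j + 1)).foldr (f n a) (s n a))) := by
      simp only [acc, hd, List.foldr_cons]
    rw [hj']
    obtain ⟨t, ht, hr⟩ := hQ n ((a, ⟨j, hj⟩), ((List.finRange n).drop (j + 1)).foldr (f n a) (s n a))
    have := Nat.mul_le_mul_right (q.eval n)
      (Nat.succ_le_succ (h n a ⟨j, hj⟩ _ (List.drop_suffix (j + 1) (List.finRange n))))
    refine ⟨_, ?_, .seq (.cons (.seq (.tail _) (.seq (.tail _) (.head _))) (.cons (.cons
      (.seq (.tail _) (.seq (.tail _) (.tail _))) (.head _)) (.seq (.tail _) (.head _)))) hr⟩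
    simp only [Nat.succ_eq_add_one] at this
    omega

theorem foldr' {f : ∀ n, α n → Fin n → γ n → γ n}
    {s : ∀ n, α n → γ n} (hf : Feasible (fun n (x : (α n × Fin n) × γ n) => τ n x.1.1)
      (fun n x => f n x.1.1 x.1.2 x.2)) (hs : Feasible τ s) :
    Feasible τ (fun n a => (List.finRange n).foldr (f n a) (s n a)) :=
  foldr hf hs fun _ _ _ _ _ => le_rfl

/-- A function on vertices is coded by its table, so abstraction means computing all `n` values and
listing them. -/
theorem lam {f : ∀ n, α n → Fin n → β n}
    (hf : Feasible (fun n (x : α n × Fin n) => τ n x.1) (fun n x => f n x.1 x.2)) :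
    Feasible τ (fun n a => fun i => f n a i) := by
  have hnil : Feasible τ (fun n _ => ([] : List (β n))) :=
    of_runsWithin .nil 1 fun _ _ => (Run.nil _).within.mono (by simp)
  have hcons : Feasible (fun n (x : (α n × Fin n) × List (β n)) => τ n x.1.1)
      (fun n x => f n x.1.1 x.1.2 :: x.2) := by
    refine comp₀ (g := fun n (x : β n × List (β n)) => x.1 :: x.2)
      (of_runsWithin .tail 1 fun n a => (Run.tail _).within.mono (by simp)) (hf.wk.pair last)
  refine (foldr' (f := fun n a i l => f n a i :: l) hcons hnil).of_code_eq fun n a => ?_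
  have : (List.finRange n).foldr (fun i l => f n a i :: l) [] = List.ofFn (f n a) := by
    rw [List.ofFn_eq_map]
    induction List.finRange n with
    | nil => rfl
    | cons i l ih => simp [ih]
  rw [this]
  simp [code, List.map_ofFn, Function.comp_def]

theorem exists' {f : ∀ n, α n → Fin n → Bool}
    (hf : Feasible (fun n (x : α n × Fin n) => τ n x.1) (fun n x => f n x.1 x.2)) :
    Feasible τ (fun n a => decide (∃ i, f n a i = Bool.true)) := by
  refine (foldr' (f := fun n a i s => f n a i || s) (hf.wk.or last) false).of_code_eq fun n a => ?_
  congr 1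
  have : ∀ l : List (Fin n), l.foldr (fun i s => f n a i || s) Bool.false
      = decide (∃ i ∈ l, f n a i = Bool.true) := by
    intro l
    induction l with
    | nil => simp
    | cons i l ih => simp [ih]
  simpa using this (List.finRange n)

theorem iterate {f : ∀ n, α n → γ n → γ n} {s : ∀ n, α n → γ n}
    (hf : Feasible (fun n (x : α n × γ n) => τ n x.1) (fun n x => f n x.1 x.2))
    (hs : Feasible τ s) : Feasible τ (fun n a => (f n a)^[n] (s n a)) := by
  refine (foldr' (f := fun n a _ x => f n a x) (hf.comp (var.fst.fst.pair last) fun _ _ => le_rfl)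
    hs).of_code_eq fun n a => ?_
  congr 1
  have : ∀ l : List (Fin n), l.foldr (fun _ x => f n a x) (s n a) = (f n a)^[l.length] (s n a) := by
    intro l
    induction l with
    | nil => rfl
    | cons i l ih => rw [List.foldr_cons, ih, List.length_cons, Function.iterate_succ_apply']
  simpa using this (List.finRange n)

/-! Lists -/

theorem nil : Feasible τ (fun n _ => ([] : List (β n))) :=
  of_runsWithin .nil 1 fun _ _ => (Run.nil _).within.mono (by simp)

theorem cons {f : ∀ n, α n → β n} {l : ∀ n, α n → List (β n)} (hf : Feasible τ f)
    (hl : Feasible τ l) : Feasible τ (fun n a => f n a :: l n a) :=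
  comp₀ (g := fun n (x : β n × List (β n)) => x.1 :: x.2)
    (of_runsWithin .tail 1 fun n a => (Run.tail _).within.mono (by simp)) (hf.pair hl)

/-- Polynomial rounds, at most `τ` of them: here the length of a list turns into a time bound. -/
theorem foldl {f : ∀ n, α n → γ n → β n → γ n} {s : ∀ n, α n → γ n} {l : ∀ n, α n → List (β n)}
    (hf : Feasible (fun _ _ => 0) (fun n (x : (α n × β n) × γ n) => f n x.1.1 x.2 x.1.2))
    (hs : Feasible τ s) (hl : Feasible τ l) (h : ∀ n a, (l n a).length ≤ τ n a) :
    Feasible τ (fun n a => (l n a).foldl (f n a) (s n a)) := by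
  obtain ⟨P, p, hP⟩ := hs
  obtain ⟨R, r, hR⟩ := hl
  obtain ⟨Q, q, hQ⟩ := hf
  let N : Prog := .seq .tail (.seq .tail .head)
  let A : Prog := .seq .tail (.seq .tail .tail)
  refine ⟨.seq (.cons R (.cons P .skip)) (.seq (Prog.forEach
    (.seq (.cons N (.cons (.cons A .head) (.seq .tail .head))) Q)) (.seq .tail .head)), p + r + q + 60,
    fun n a => ?_⟩
  have hrun := RunsWithin.forEach (Q := (.seq (.cons N (.cons (.cons A .head) (.seq .tail .head))) Q))
    (c := .cons (encodeNat n) (code a)) (enc := code (α := β)) (encAcc := code (α := γ))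
    (f := f n a) (T := q.eval n + 20)
    (fun b s => ?_) (l n a) (s n a)
  · refine ((((hR n a).cons ((hP n a).cons (Run.skip _).within))).seq
      (hrun.seq (Run.seq (.tail _) (.head _)).within)).mono ?_
    have := Nat.mul_le_mul_right (q.eval n + 20 + 20) (h n a)
    simp only [Polynomial.eval_add, Polynomial.eval_ofNat]
    nlinarith
  · obtain ⟨t, ht, hr⟩ := hQ n ((a, b), s)
    refine ⟨_, ?_, .seq (.cons (.seq (.tail _) (.seq (.tail _) (.head _))) (.cons (.cons
      (.seq (.tail _) (.seq (.tail _) (.tail _))) (.head _)) (.seq (.tail _) (.head _)))) hr⟩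
    simp only [Nat.zero_add, Nat.one_mul] at ht
    omega

end Feasible

/-! ### The algorithm -/

/-- The next level, if there is one. -/
def Level.succ {n : ℕ} (x : Level n) : Level n := ⟨min (x.val + 1) (n + 1), by omega⟩

/-- The number of members of a set. -/
def countTrue {n : ℕ} (s : Fin n → Bool) : ℕ :=
  (List.finRange n).foldr (fun i c => if s i = true then c + 1 else c) 0

/-! ### Finding a 2-colouring by merging classes. -/

section Coloring

variable {n : ℕ} (g : Fin n → Fin n → Bool) (s : Fin n → Bool)

/-- Vertices are labelled by classes and colours. If `u v` is an edge avoiding `s`, the classes of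
its ends are joined, and the colours of one of them are exchanged if necessary. -/
def mergeStep (u v : Fin n) (x : (Fin n → Fin n) × (Fin n → Bool)) :
    (Fin n → Fin n) × (Fin n → Bool) :=
  if (g u v && (!s u && !s v)) = true then
    (fun w => if (x.1 w == x.1 u) = true then x.1 v else x.1 w,
      fun w => if (x.1 w == x.1 u && x.2 u == x.2 v) = true then !x.2 w else x.2 w)
  else x

/-- A proper 2-colouring outside `s`, if there is one. -/
def twoColoring : Fin n → Bool :=
  ((List.finRange n).foldr (fun u x => (List.finRange n).foldr (fun v x => mergeStep g s u v x) x)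
    (fun w => w, fun _ => false)).2

end Coloring

/-! ### Minimum vertex covers of bipartite graphs by an auction. -/

section Auction

variable {n : ℕ} (e : Fin n → Fin n → Bool)

/-- The state of the auction: the price and the owner of each right vertex. -/
abbrev AuctionState (n : ℕ) : Type := (Fin n → Level n) × (Fin n → Option (Fin n))

/-- The left vertex `u` owns nothing, can afford `v`, and cannot find anything cheaper. -/
def wants (x : AuctionState n) (u v : Fin n) : Bool :=
  -- The default `u` in `getD u` does no harm, because `isSome` is tested as well.
  e u v && (!decide (∃ w, ((x.2 w).isSome && (x.2 w).getD u == u) = true) &&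
    (decide ((x.1 v).val ≤ n) &&
      !decide (∃ w, (e u w && !decide ((x.1 v).val ≤ (x.1 w).val)) = true)))

/-- If `u` wants `v`, it becomes the owner of `v`, whose price rises. -/
def bid (u v : Fin n) (x : AuctionState n) : AuctionState n :=
  if wants e x u v = true then
    (fun w => if (w == v) = true then (x.1 w).succ else x.1 w,
      fun w => if (w == v) = true then some u else x.2 w)
  else x

/-- All pairs get the opportunity of a bid. -/
def biddingRound (x : AuctionState n) : AuctionState n :=
  (List.finRange n).foldr (fun u x => (List.finRange n).foldr (fun v x => bid e u v x) x) x

/-- The state of the auction after `(n + 1) * n` rounds. -/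
def auction : AuctionState n :=
  -- The number of rounds `(n + 1) * n` is the largest possible sum of the prices; it is nested
  -- because the basic iteration has length `n`.
  (fun x => (biddingRound e)^[n] (biddingRound e x))^[n] (fun _ => ⟨0, by omega⟩, fun _ => none)

/-- A level that is not the price of any vertex. -/
def priceGap (x : AuctionState n) : Level n :=
  (List.finRange n).foldr
    (fun i p => if decide (∃ v, decide ((x.1 v).val = i.val) = true) = true then p
      else ⟨i.val, by omega⟩) ⟨n, by omega⟩

/-- The left vertices of the vertex cover obtained from an auction. -/
def leftCover (x : AuctionState n) (u : Fin n) : Bool :=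
  decide (∃ v, ((x.2 v).isSome && (x.2 v).getD u == u && !decide ((priceGap x).val ≤ (x.1 v).val))
    = true)

/-- The right vertices of the vertex cover obtained from an auction. -/
def rightCover (x : AuctionState n) (v : Fin n) : Bool :=
  !decide ((x.1 v).val ≤ (priceGap x).val)

end Auction

/-! ### Search through the partial colourings, and iterative compression. -/

section Search

variable {n : ℕ} (g : Fin n → Fin n → Bool) (s : Fin n → Bool)

/-- The vertex `v` has the colour `b` under `σ`. -/
def hasColor (σ : Fin n → Option Bool) (v : Fin n) (b : Bool) : Bool :=
  (σ v).isSome && (σ v).getD b == b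

/-- The vertex `v` has a neighbour of the colour `b`. -/
def forbidden (σ : Fin n → Option Bool) (v : Fin n) (b : Bool) : Bool :=
  decide (∃ w, (g v w && hasColor σ w b) = true)

/-- Two adjacent vertices have the same colour under `σ`. -/
def conflict (σ : Fin n → Option Bool) : Bool :=
  decide (∃ v, (hasColor σ v true && forbidden g σ v true ||
    hasColor σ v false && forbidden g σ v false) = true)

/-- The bipartite graph whose vertex covers are sought: a left vertex `u` stands for the vertex `u`
with its colour under `φ`, and a right vertex `v` for the vertex `v` with the other colour. -/
def coverGraph (φ : Fin n → Bool) (σ : Fin n → Option Bool) (u v : Fin n) : Bool :=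
  -- For an edge `u v` outside `s`, `φ u = !φ v`, so the two copies lie in the same layer of `H²`;
  -- the case `u = v` is the edge between the two copies of a vertex. The forced copies are left
  -- out.
  (u == v || g u v) && ((!s u && !s v) && (!forbidden g σ u (φ u) && !forbidden g σ v (!φ v)))

/-- The set to be deleted, computed from a vertex cover. -/
def candidate (φ : Fin n → Bool) (σ : Fin n → Option Bool) (x : AuctionState n) (v : Fin n) :
    Bool :=
  -- The domain of `σ` is `T` and its values give `Y`, so an uncoloured vertex of `s` is deleted. A
  -- vertex outside `s` is deleted when both of its copies are forced or in the cover.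
  if s v = true then !(σ v).isSome
  else (forbidden g σ v (φ v) || leftCover x v) && (forbidden g σ v (!φ v) || rightCover x v)

/-- The better of the set `y` and of the set computed from the partial colouring `σ` of `s`. -/
def improve (φ : Fin n → Bool) (y : Fin n → Bool) (σ : Fin n → Option Bool) : Fin n → Bool :=
  if conflict g σ = true then y
  else if decide (countTrue y ≤
    countTrue (candidate g s φ σ (auction (coverGraph g s φ σ)))) = true then y
  else candidate g s φ σ (auction (coverGraph g s φ σ))

/-- Adds to a list of partial colourings all those that differ only at `i`. -/
def expandAt (i : Fin n) (l : List (Fin n → Option Bool)) : List (Fin n → Option Bool) :=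
  l.foldl (fun l σ => σ :: (fun w => if (w == i) = true then some true else σ w) ::
    (fun w => if (w == i) = true then some false else σ w) :: l) []

/-- All partial colourings of the set `s`. -/
def partialColorings : List (Fin n → Option Bool) :=
  (List.finRange n).foldr (fun i l => if s i = true then expandAt i l else l) [fun _ => none]

/-- A smallest odd cycle transversal, if it is smaller than the odd cycle transversal `s`. -/
def bestTransversal : Fin n → Bool :=
  (partialColorings s).foldl (improve g s (twoColoring g s)) s

/-- The compression step. -/
def compressStep : Option (Fin n → Bool) :=
  if decide (countTrue s ≤ countTrue (bestTransversal g s)) = true then none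
  else some (bestTransversal g s)

/-- The adjacency matrix of a graph without the edges that leave the set `a`. -/
def maskMatrix (a : Fin n → Bool) (u w : Fin n) : Bool := g u w && (a u && a w)

/-- One step of iterative compression: the addition of the vertex `v`. The state consists of the
information whether a solution is known, the set of vertices added so far, and the solution. -/
def iterStep (k : ℕ) (v : Fin n) (x : Bool × (Fin n → Bool) × (Fin n → Bool)) :
    Bool × (Fin n → Bool) × (Fin n → Bool) :=
  let a := fun w => w == v || x.2.1 w
  let y := fun w => w == v || x.2.2 w
  if x.1 = true then
    if decide (countTrue y ≤ k) = true then (true, a, y)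
    -- In an actual run this test always succeeds here; it bounds the exponent of the running time
    -- for arbitrary states.
    else if decide (countTrue y ≤ k + 1) = true then
      let o := compressStep (maskMatrix g a) y
      (o.isSome, a, o.getD y)
    else (false, a, y)
  else x

/-- Iterative compression. -/
def iterCompress (k : ℕ) : Option (Fin n → Bool) :=
  let x := (List.finRange n).foldr (iterStep g k) (true, fun _ => false, fun _ => false)
  if x.1 = true then some x.2.2 else none

end Search

/-! ### The running time of the algorithm -/

theorem countTrue_eq_card {n : ℕ} (s : Fin n → Bool) :
    countTrue s = (Finset.univ.filter fun i => s i = true).card := by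
  have : ∀ l : List (Fin n), l.foldr (fun i c => if s i = true then c + 1 else c) 0
      = (l.filter fun i => s i).length := by
    intro l
    induction l with
    | nil => rfl
    | cons i l ih => rw [List.foldr_cons, ih, List.filter_cons]; split_ifs <;> simp
  rw [countTrue, this, ← List.toFinset_card_of_nodup ((List.nodup_finRange n).filter _)]
  congr 1
  ext i
  simp

theorem countTrue_le {n : ℕ} (s : Fin n → Bool) : countTrue s ≤ n := by
  rw [countTrue_eq_card]
  exact (Finset.card_le_univ _).trans_eq (Fintype.card_fin n)

namespace Feasible

variable {α : ℕ → Type} [Code α] {τ : ∀ n, α n → ℕ}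

theorem levelSucc {f : ∀ n, α n → Level n} (hf : Feasible τ f) :
    Feasible τ (fun n a => (f n a).succ) :=
  (ite (le hf.levelVal order fun n a => by have := (f n a).lt; omega) hf.levelVal.succ
    hf.levelVal).of_code_eq fun n a => by
      have := (f n a).lt
      show encodeNat _ = encodeNat (min _ _)
      congr 1
      by_cases h : (f n a).val ≤ n
      · simp [h]
      · simp [h]; omega

theorem levelLe {f g : ∀ n, α n → Level n} (hf : Feasible τ f) (hg : Feasible τ g) :
    Feasible τ (fun n a => decide ((f n a).val ≤ (g n a).val)) :=
  hf.levelVal.le hg.levelVal fun n a => by have := (f n a).lt; omega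

theorem count {s : ∀ n, α n → Fin n → Bool} (hs : Feasible τ s) :
    Feasible τ (fun n a => countTrue (s n a)) :=
  foldr' (f := fun n a i c => if s n a i = Bool.true then c + 1 else c)
    (ite (hs.wk.wk.app var.fst.snd) last.succ last) zero

theorem countLe {s : ∀ n, α n → Fin n → Bool} {k : ∀ n, α n → ℕ} (hs : Feasible τ s)
    (hk : Feasible τ k) : Feasible τ (fun n a => decide (countTrue (s n a) ≤ k n a)) :=
  hs.count.le hk fun n _ => (countTrue_le _).trans n.le_succ

theorem optionBeq {f : ∀ n, α n → Option (Fin n)} {u : ∀ n, α n → Fin n} (hf : Feasible τ f)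
    (hu : Feasible τ u) : Feasible τ (fun n a => (f n a).isSome && (f n a).getD (u n a) == u n a) :=
  hf.isSome.and ((hf.getD hu).finBeq hu)

section Coloring

variable {g : ∀ n, α n → Fin n → Fin n → Bool} {s : ∀ n, α n → Fin n → Bool}

theorem merge {u v : ∀ n, α n → Fin n} {x : ∀ n, α n → (Fin n → Fin n) × (Fin n → Bool)}
    (hg : Feasible τ g) (hs : Feasible τ s) (hu : Feasible τ u) (hv : Feasible τ v)
    (hx : Feasible τ x) :
    Feasible τ (fun n a => mergeStep (g n a) (s n a) (u n a) (v n a) (x n a)) := by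
  have h : Feasible (fun n (y : α n × Fin n) => τ n y.1)
      (fun n y => (x n y.1).1 y.2 == (x n y.1).1 (u n y.1)) :=
    (hx.fst.wk.app last).finBeq (hx.fst.wk.app hu.wk)
  exact ite (((hg.app hu).app hv).and ((hs.app hu).not.and (hs.app hv).not))
    (pair (lam (ite h (hx.fst.wk.app hv.wk) (hx.fst.wk.app last)))
      (lam (ite (h.and ((hx.snd.wk.app hu.wk).beq (hx.snd.wk.app hv.wk)))
        (hx.snd.wk.app last).not (hx.snd.wk.app last)))) hx

theorem coloring (hg : Feasible τ g) (hs : Feasible τ s) :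
    Feasible τ (fun n a => twoColoring (g n a) (s n a)) := by
  refine snd (foldr' (γ := fun n => (Fin n → Fin n) × (Fin n → Bool)) (f := fun n a u x =>
    (List.finRange n).foldr (fun v x => mergeStep (g n a) (s n a) u v x) x) ?_
    (pair (lam last) (lam false)))
  exact foldr' (f := fun n (y : (α n × Fin n) × ((Fin n → Fin n) × (Fin n → Bool))) v x =>
    mergeStep (g n y.1.1) (s n y.1.1) y.1.2 v x)
    (merge hg.wk.wk.wk.wk hs.wk.wk.wk.wk var.fst.fst.fst.snd var.fst.snd last) last

end Coloring

section Auction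

variable {e : ∀ n, α n → Fin n → Fin n → Bool} {x : ∀ n, α n → AuctionState n}

theorem wanting {u v : ∀ n, α n → Fin n} (he : Feasible τ e) (hx : Feasible τ x)
    (hu : Feasible τ u) (hv : Feasible τ v) :
    Feasible τ (fun n a => wants (e n a) (x n a) (u n a) (v n a)) :=
  ((he.app hu).app hv).and
    ((exists' (optionBeq (hx.snd.wk.app last) hu.wk)).not.and
      (((hx.fst.app hv).levelVal.le order fun n a => by
          have := ((x n a).1 (v n a)).lt; omega).and
        (exists' (((he.wk.app hu.wk).app last).and
          (levelLe (hx.fst.wk.app hv.wk) (hx.fst.wk.app last)).not)).not))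

theorem bidding {u v : ∀ n, α n → Fin n} (he : Feasible τ e) (hu : Feasible τ u)
    (hv : Feasible τ v) (hx : Feasible τ x) :
    Feasible τ (fun n a => bid (e n a) (u n a) (v n a) (x n a)) :=
  ite (he.wanting hx hu hv)
    (pair
      (lam (ite (finBeq last hv.wk) (hx.fst.wk.app last).levelSucc (hx.fst.wk.app last)))
      (lam (ite (finBeq last hv.wk) hu.wk.some (hx.snd.wk.app last)))) hx

theorem round (he : Feasible τ e) (hx : Feasible τ x) :
    Feasible τ (fun n a => biddingRound (e n a) (x n a)) := by
  refine foldr' (γ := fun n => AuctionState n) (f := fun n a u x =>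
    (List.finRange n).foldr (fun v x => bid (e n a) u v x) x) ?_ hx
  exact foldr' (f := fun n (y : (α n × Fin n) × AuctionState n) v x => bid (e n y.1.1) y.1.2 v x)
    (bidding he.wk.wk.wk.wk var.fst.fst.fst.snd var.fst.snd last) last

theorem auctioning (he : Feasible τ e) : Feasible τ (fun n a => auction (e n a)) := by
  refine iterate (γ := fun n => AuctionState n)
    (f := fun n a x => (biddingRound (e n a))^[n] (biddingRound (e n a) x)) ?_
    (pair (lam (toLevel zero fun _ _ => by omega)) (lam none))
  exact iterate (f := fun n (y : α n × AuctionState n) x => biddingRound (e n y.1) x)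
    (round he.wk.wk last) (round he.wk last)

theorem gap (hx : Feasible τ x) : Feasible τ (fun n a => priceGap (x n a)) :=
  foldr' (f := fun n a (i : Fin n) (p : Level n) =>
      if decide (∃ v, decide (((x n a).1 v).val = i.val) = Bool.true) = Bool.true then p
      else ⟨i.val, by omega⟩)
    (ite (exists' (eq (hx.fst.wk.wk.wk.app last).levelVal (finVal var.fst.fst.snd)
        (fun n a => by have := ((x n a.1.1.1).1 a.2).lt; omega) fun n a => by omega))
      last (toLevel (finVal var.fst.snd) fun n a => by omega))
    (toLevel order fun n _ => by omega)

theorem left {u : ∀ n, α n → Fin n} (hx : Feasible τ x) (hu : Feasible τ u) :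
    Feasible τ (fun n a => leftCover (x n a) (u n a)) :=
  exists' ((optionBeq (hx.snd.wk.app last) hu.wk).and
    (levelLe hx.gap.wk (hx.fst.wk.app last)).not)

theorem right {u : ∀ n, α n → Fin n} (hx : Feasible τ x) (hu : Feasible τ u) :
    Feasible τ (fun n a => rightCover (x n a) (u n a)) :=
  (levelLe (hx.fst.app hu) hx.gap).not

end Auction

section Search

variable {g : ∀ n, α n → Fin n → Fin n → Bool} {s φ : ∀ n, α n → Fin n → Bool}
  {σ : ∀ n, α n → Fin n → Option Bool}

theorem color {v : ∀ n, α n → Fin n} {b : ∀ n, α n → Bool} (hσ : Feasible τ σ)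
    (hv : Feasible τ v) (hb : Feasible τ b) :
    Feasible τ (fun n a => hasColor (σ n a) (v n a) (b n a)) :=
  (hσ.app hv).isSome.and (((hσ.app hv).getD hb).beq hb)

theorem forbid {v : ∀ n, α n → Fin n} {b : ∀ n, α n → Bool} (hg : Feasible τ g)
    (hσ : Feasible τ σ) (hv : Feasible τ v) (hb : Feasible τ b) :
    Feasible τ (fun n a => forbidden (g n a) (σ n a) (v n a) (b n a)) :=
  exists' (((hg.wk.app hv.wk).app last).and (color hσ.wk last hb.wk))

theorem conflicting (hg : Feasible τ g) (hσ : Feasible τ σ) :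
    Feasible τ (fun n a => conflict (g n a) (σ n a)) :=
  exists' (((color hσ.wk last true).and (hg.wk.forbid hσ.wk last true)).or
    ((color hσ.wk last false).and (hg.wk.forbid hσ.wk last false)))

theorem cover (hg : Feasible τ g) (hs : Feasible τ s) (hφ : Feasible τ φ) (hσ : Feasible τ σ) :
    Feasible τ (fun n a => coverGraph (g n a) (s n a) (φ n a) (σ n a)) := by
  refine lam (f := fun n a u => coverGraph (g n a) (s n a) (φ n a) (σ n a) u)
    (lam (f := fun n (y : α n × Fin n) v =>
      coverGraph (g n y.1) (s n y.1) (φ n y.1) (σ n y.1) y.2 v) ?_)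
  have hu : Feasible (fun n (y : (α n × Fin n) × Fin n) => τ n y.1.1) (fun n y => y.1.2) :=
    var.fst.snd
  exact ((finBeq hu last).or ((hg.wk.wk.app hu).app last)).and
    (((hs.wk.wk.app hu).not.and (hs.wk.wk.app last).not).and
      ((hg.wk.wk.forbid hσ.wk.wk hu (hφ.wk.wk.app hu)).not.and
        (hg.wk.wk.forbid hσ.wk.wk last (hφ.wk.wk.app last).not).not))

theorem cand {x : ∀ n, α n → AuctionState n} (hg : Feasible τ g) (hs : Feasible τ s)
    (hφ : Feasible τ φ) (hσ : Feasible τ σ) (hx : Feasible τ x) :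
    Feasible τ (fun n a => candidate (g n a) (s n a) (φ n a) (σ n a) (x n a)) :=
  lam (f := fun n a => candidate (g n a) (s n a) (φ n a) (σ n a) (x n a))
    (ite (hs.wk.app last) (hσ.wk.app last).isSome.not
      (((hg.wk.forbid hσ.wk last (hφ.wk.app last)).or (hx.wk.left last)).and
        ((hg.wk.forbid hσ.wk last (hφ.wk.app last).not).or (hx.wk.right last))))

theorem improving {y : ∀ n, α n → Fin n → Bool} (hg : Feasible τ g) (hs : Feasible τ s)
    (hφ : Feasible τ φ) (hy : Feasible τ y) (hσ : Feasible τ σ) :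
    Feasible τ (fun n a => improve (g n a) (s n a) (φ n a) (y n a) (σ n a)) :=
  have h := hg.cand hs hφ hσ (hg.cover hs hφ hσ).auctioning
  ite (hg.conflicting hσ) hy (ite (countLe hy h.count) hy h)

end Search

end Feasible

theorem length_expandAt {n : ℕ} (i : Fin n) (l : List (Fin n → Option Bool)) :
    (expandAt i l).length = 3 * l.length := by
  have : ∀ m : List (Fin n → Option Bool), (l.foldl (fun l σ =>
      σ :: (fun w => if (w == i) = true then some true else σ w) ::
        (fun w => if (w == i) = true then some false else σ w) :: l) m).length
      = 3 * l.length + m.length := by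
    induction l with
    | nil => simp
    | cons σ l ih => intro m; rw [List.foldl_cons, ih]; simp only [List.length_cons]; omega
  exact this []

/-- Needed for every list `l`, since the time analysis bounds the accumulator on each suffix of
`List.finRange n`. -/
theorem length_foldr_expandAt {n : ℕ} (s : Fin n → Bool) (l : List (Fin n)) :
    (l.foldr (fun i l => if s i = true then expandAt i l else l) [fun _ => none]).length
      = 3 ^ (l.filter fun i => s i).length := by
  induction l with
  | nil => rfl
  | cons i l ih =>
    rw [List.foldr_cons, List.filter_cons]
    split_ifs
    · rw [length_expandAt, ih, List.length_cons, pow_succ, mul_comm]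
    · exact ih

theorem countTrue_eq_length {n : ℕ} (s : Fin n → Bool) :
    countTrue s = ((List.finRange n).filter fun i => s i).length := by
  rw [countTrue_eq_card, ← List.toFinset_card_of_nodup ((List.nodup_finRange n).filter _)]
  congr 1
  ext i
  simp

namespace Feasible

theorem partials : Feasible (α := fun n => Fin n → Bool) (fun _ s => 3 ^ countTrue s)
    (fun _ s => partialColorings s) := by
  have hexp : Feasible (α := fun n => Fin n × List (Fin n → Option Bool))
      (fun _ x => x.2.length) (fun _ x => expandAt x.1 x.2) := by
    refine foldl (f := fun n (x : Fin n × List (Fin n → Option Bool)) l σ =>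
      σ :: (fun w => if (w == x.1) = Bool.true then Option.some Bool.true else σ w) ::
      (fun w => if (w == x.1) = Bool.true then Option.some Bool.false else σ w) :: l)
      ?_ nil var.snd fun _ _ => le_rfl
    have hw : Feasible (fun n (y : (((Fin n × List (Fin n → Option Bool)) × (Fin n → Option Bool))
        × List (Fin n → Option Bool)) × Fin n) => 0) (fun n y => y.2 == y.1.1.1.1) :=
      finBeq last var.fst.fst.fst.fst
    exact cons var.fst.snd (cons
      (lam (ite hw true.some (app var.fst.fst.snd last)))
      (cons (lam (ite hw false.some (app var.fst.fst.snd last))) last))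
  have hbody : Feasible (α := fun n => ((Fin n → Bool) × Fin n) × List (Fin n → Option Bool))
      (fun _ x => x.2.length)
      (fun _ x => if x.1.1 x.1.2 = Bool.true then expandAt x.1.2 x.2 else x.2) :=
    ite (app var.fst.fst var.fst.snd) (hexp.comp (pair var.fst.snd last) fun _ _ => le_rfl) last
  refine foldr (f := fun n (s : Fin n → Bool) i l => if s i = Bool.true then expandAt i l else l)
    hbody (cons (lam none) nil) fun n s i l hl => ?_
  rw [length_foldr_expandAt, countTrue_eq_length]
  exact Nat.pow_le_pow_right (by omega) (hl.sublist.filter _).length_le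

/-- The 2-colouring is computed once and stored in the context; each of the `3 ^ countTrue s`
partial colourings then costs polynomial time. -/
theorem best : Feasible (α := fun n => (Fin n → Fin n → Bool) × (Fin n → Bool))
    (fun _ x => 3 ^ countTrue x.2) (fun _ x => bestTransversal x.1 x.2) := by
  have hfold : Feasible (α := fun n => ((Fin n → Fin n → Bool) × (Fin n → Bool)) ×
      (Fin n → Bool)) (fun _ x => 3 ^ countTrue x.1.2)
      (fun _ x => (partialColorings x.1.2).foldl (improve x.1.1 x.1.2 x.2) x.1.2) := by
    refine foldl (f := fun n (x : ((Fin n → Fin n → Bool) × (Fin n → Bool)) × (Fin n → Bool)) y σ =>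
      improve x.1.1 x.1.2 x.2 y σ) ?_ var.fst.snd
      (partials.comp var.fst.snd fun _ _ => le_rfl) fun n x => ?_
    · exact improving var.fst.fst.fst.fst var.fst.fst.fst.snd var.fst.fst.snd last var.fst.snd
    · rw [partialColorings, length_foldr_expandAt, countTrue_eq_length]
  exact hfold.comp (pair var (coloring var.fst var.snd)) fun _ _ => le_rfl

theorem compress : Feasible (α := fun n => (Fin n → Fin n → Bool) × (Fin n → Bool))
    (fun _ x => 3 ^ countTrue x.2) (fun _ x => compressStep x.1 x.2) :=
  ite (countLe var.snd best.count) none best.some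

theorem mask {α : ℕ → Type} [Code α] {τ : ∀ n, α n → ℕ} {g : ∀ n, α n → Fin n → Fin n → Bool}
    {a : ∀ n, α n → Fin n → Bool} (ha : Feasible τ a) (hg : Feasible τ g) :
    Feasible τ (fun n x => maskMatrix (g n x) (a n x)) :=
  lam (f := fun n x u => maskMatrix (g n x) (a n x) u)
    (lam (f := fun n (y : α n × Fin n) w => maskMatrix (g n y.1) (a n y.1) y.2 w)
      (((hg.wk.wk.app var.fst.snd).app last).and
        ((ha.wk.wk.app var.fst.snd).and (ha.wk.wk.app last))))

theorem iterative : Feasible (α := fun n => (Fin n → Fin n → Bool) × ℕ)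
    (fun _ x => 3 ^ (x.2 + 1)) (fun _ x => iterCompress x.1 x.2) := by
  have hstep : Feasible
      (α := fun n => (((Fin n → Fin n → Bool) × ℕ) × Fin n) ×
        (Bool × (Fin n → Bool) × (Fin n → Bool)))
      (fun _ x => 3 ^ (x.1.1.2 + 1)) (fun _ x => iterStep x.1.1.1 x.1.1.2 x.1.2 x.2) := by
    have ha : Feasible
      (α := fun n => (((Fin n → Fin n → Bool) × ℕ) × Fin n) ×
        (Bool × (Fin n → Bool) × (Fin n → Bool))) (fun _ x => 0)
        (fun n x => fun w : Fin n => w == x.1.2 || x.2.2.1 w) :=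
      lam ((finBeq last var.fst.fst.snd).or (app var.fst.snd.snd.fst last))
    have hy : Feasible
      (α := fun n => (((Fin n → Fin n → Bool) × ℕ) × Fin n) ×
        (Bool × (Fin n → Bool) × (Fin n → Bool))) (fun _ x => 0)
        (fun n x => fun w : Fin n => w == x.1.2 || x.2.2.2 w) :=
      lam ((finBeq last var.fst.fst.snd).or (app var.fst.snd.snd.snd last))
    have ho := compress.comp ((ha.mask var.fst.fst.fst).pair hy).of_poly
      (τ := fun n x => 3 ^ countTrue (fun w => w == x.1.2 || x.2.2.2 w)) fun _ _ => le_rfl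
    refine ite var.snd.fst (ite (countLe hy.of_poly var.fst.fst.snd)
      (pair true (pair ha.of_poly hy.of_poly))
      -- Compression is charged only where the test succeeds, which gives the exponent `k + 1`.
      (ite' (countLe hy.of_poly var.fst.fst.snd.succ)
        (pair ho.isSome (pair ha.of_poly (ho.getD hy.of_poly)))
        (pair false (pair ha.of_poly hy.of_poly)) (fun n x hx => ?_) fun _ _ _ => le_rfl)) last
    exact Nat.pow_le_pow_right (by omega) (of_decide_eq_true hx)
  have hfold : Feasible (α := fun n => (Fin n → Fin n → Bool) × ℕ) (fun _ x => 3 ^ (x.2 + 1))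
      (fun n x => (List.finRange n).foldr (iterStep x.1 x.2)
        (Bool.true, (fun _ => Bool.false), fun _ => Bool.false)) :=
    foldr' hstep (pair true (pair (lam false) (lam false)))
  exact ite hfold.fst hfold.snd.snd.some none

end Feasible

/-! ### Correctness of the algorithm -/

/-! ### Invariants and potentials of folds and iterations. -/

theorem List.foldr_invariant {ι X : Type*} {f : ι → X → X} {I : X → Prop}
    (h : ∀ i x, I x → I (f i x)) {x : X} (hx : I x) (l : List ι) : I (l.foldr f x) := by
  induction l with
  | nil => exact hx
  | cons i l ih => exact h i _ ih

theorem List.foldr_establishes {ι X : Type*} {f : ι → X → X} {I Q : X → Prop}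
    (hI : ∀ i x, I x → I (f i x)) (hQ : ∀ i x, I x → Q x → Q (f i x)) {i : ι}
    (hi : ∀ x, I x → Q (f i x)) {x : X} (hx : I x) {l : List ι} (hil : i ∈ l) :
    Q (l.foldr f x) := by
  induction l with
  | nil => simp at hil
  | cons j l ih =>
    have hl := List.foldr_invariant hI hx l
    rcases List.mem_cons.1 hil with rfl | h
    · exact hi _ hl
    · exact hQ j _ hl (ih h)

/-- The potential never falls, so a single effective step raises it for the whole fold; otherwise
every step met the original state and left it alone. -/
theorem List.foldr_eq_or_lt {ι X : Type*} {f : ι → X → X} {Φ : X → ℕ}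
    (h : ∀ i x, f i x = x ∨ Φ x < Φ (f i x)) (x : X) (l : List ι) :
    (l.foldr f x = x ∧ ∀ i ∈ l, f i x = x) ∨ Φ x < Φ (l.foldr f x) := by
  induction l with
  | nil => simp
  | cons i l ih =>
    rw [List.foldr_cons]
    rcases ih with ⟨h₁, h₂⟩ | h₁
    · rw [h₁]
      rcases h i x with h₃ | h₃
      · exact .inl ⟨h₃, by simpa using ⟨h₃, h₂⟩⟩
      · exact .inr h₃
    · right
      rcases h i (l.foldr f x) with h₃ | h₃
      · rwa [h₃]
      · exact h₁.trans h₃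

/-- Each iteration before a fixed point raises the potential, which would exceed `m` after `m + 1`
effective iterations. -/
theorem Function.iterate_isFixedPt_of_bounded {X : Type*} {f : X → X} {Φ : X → ℕ} {m : ℕ}
    (h : ∀ x, f x = x ∨ Φ x < Φ (f x)) (hm : ∀ x, Φ x ≤ m) (x : X) : f (f^[m] x) = f^[m] x := by
  have key : ∀ j, f (f^[j] x) = f^[j] x ∨ j < Φ (f^[j + 1] x) := by
    intro j
    induction j with
    | zero =>
      rcases h x with h | h
      · exact .inl h
      · exact .inr (by simpa using Nat.zero_lt_of_lt h)
    | succ j ih =>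
      rw [Function.iterate_succ_apply' f (j + 1), Function.iterate_succ_apply' f j] at *
      rcases ih with ih | ih
      · left; rw [ih, ih]
      · rcases h (f (f^[j] x)) with h | h
        · exact .inl h
        · exact .inr (by omega)
  exact (key m).resolve_right (not_lt.2 (hm _))

theorem countTrue_eq_sum {n : ℕ} (s : Fin n → Bool) : countTrue s = ∑ i, (s i).toNat := by
  rw [countTrue_eq_card, Finset.card_filter]
  exact Finset.sum_congr rfl fun i _ => by cases s i <;> rfl

/-! ### Correctness of the 2-colouring. -/

section Coloring

variable {n : ℕ} {g : Fin n → Fin n → Bool} {s : Fin n → Bool}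

/-- `c` is a proper 2-colouring of the graph with adjacency matrix `g` outside the set `z`. -/
def ProperOff (g : Fin n → Fin n → Bool) (z c : Fin n → Bool) : Prop :=
  ∀ u v, z u = false → z v = false → g u v = true → c u ≠ c v

/-- In each class, the colours agree with `c` up to an exchange. -/
def AgreesOnClasses (c : Fin n → Bool) (x : (Fin n → Fin n) × (Fin n → Bool)) : Prop :=
  ∀ w w', x.1 w = x.1 w' → (x.2 w = x.2 w' ↔ c w = c w')

/-- The colouring `c` is a certificate unknown to the algorithm. The ends of an edge have different
colours under `c`, so exchanging colours when `u` and `v` look alike makes their classes fit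
together. If they already share a class, the invariant says that they look different, and nothing is
exchanged. -/
theorem AgreesOnClasses.mergeStep {c : Fin n → Bool} (hc : ProperOff g s c) (u v : Fin n)
    {x : (Fin n → Fin n) × (Fin n → Bool)} (hx : AgreesOnClasses c x) :
    AgreesOnClasses c (mergeStep g s u v x) := by
  unfold _root_.mergeStep
  split_ifs with h
  · simp only [Bool.and_eq_true, Bool.not_eq_true'] at h
    have huv := hc u v h.2.1 h.2.2 h.1
    intro w w' hww
    have h₁ := hx w w'
    have h₂ := hx w u
    have h₃ := hx w' u
    have h₄ := hx w v
    have h₅ := hx w' v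
    simp only [beq_iff_eq, Bool.and_eq_true] at hww ⊢
    revert h₁ h₂ h₃ h₄ h₅ huv
    -- Only the class of `u` is relabelled. Where it contains `w` or `w'`, a finite check on truth
    -- values remains.
    by_cases ha : x.1 w = x.1 u <;> by_cases hb : x.1 w' = x.1 u <;>
      simp only [ha, hb, if_true, if_false, true_and, false_and] at hww ⊢
    · generalize x.2 w = a; generalize x.2 w' = b; generalize x.2 u = d; generalize x.2 v = e
      generalize c w = a'; generalize c w' = b'; generalize c u = d'; generalize c v = e'
      intro h₀ h₁ h₂ h₃ _ _
      revert h₁ h₂ h₃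
      cases d <;> cases e <;> simp <;> exact fun h _ _ => h
    · rw [← hww]
      generalize x.2 w = a; generalize x.2 w' = b; generalize x.2 u = d; generalize x.2 v = e
      generalize c w = a'; generalize c w' = b'; generalize c u = d'; generalize c v = e'
      intro h₀ _ h₂ _ _ h₅
      revert h₀ h₂ h₅
      cases d <;> cases e <;> cases a <;> cases b <;> cases a' <;> cases b' <;> cases d' <;>
        cases e' <;> simp
    · rw [hww]
      generalize x.2 w = a; generalize x.2 w' = b; generalize x.2 u = d; generalize x.2 v = e
      generalize c w = a'; generalize c w' = b'; generalize c u = d'; generalize c v = e'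
      intro h₀ _ _ h₃ h₄ _
      revert h₀ h₃ h₄
      cases d <;> cases e <;> cases a <;> cases b <;> cases a' <;> cases b' <;> cases d' <;>
        cases e' <;> simp
    · exact fun _ h _ _ _ _ => h hww
  · exact hx

theorem mergeStep_class {u v w w' : Fin n} {x : (Fin n → Fin n) × (Fin n → Bool)}
    (h : x.1 w = x.1 w') : (mergeStep g s u v x).1 w = (mergeStep g s u v x).1 w' := by
  unfold mergeStep
  split_ifs
  · simp only [h]
  · exact h

theorem mergeStep_edge {u v : Fin n} (hu : s u = false) (hv : s v = false) (huv : g u v = true)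
    (x : (Fin n → Fin n) × (Fin n → Bool)) :
    (mergeStep g s u v x).1 u = (mergeStep g s u v x).1 v := by
  unfold mergeStep
  rw [if_pos (by simp [hu, hv, huv])]
  simp

/-- The step for the pair `u, v` puts both ends of an edge into one class and later steps never
split classes; within a class the colours distinguish what `c` distinguishes. -/
theorem properOff_twoColoring {c : Fin n → Bool} (hc : ProperOff g s c) :
    ProperOff g s (twoColoring g s) := by
  intro u v hu hv huv
  let f : Fin n → (Fin n → Fin n) × (Fin n → Bool) → (Fin n → Fin n) × (Fin n → Bool) :=
    fun u x => (List.finRange n).foldr (fun v x => mergeStep g s u v x) x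
  let x := (List.finRange n).foldr f (fun w => w, fun _ => false)
  have h₁ : AgreesOnClasses c x :=
    List.foldr_invariant (fun i x hx => List.foldr_invariant
      (fun j x hx => hx.mergeStep hc i j) hx _) (fun w w' h => by simp [show w = w' from h]) _
  have hQ : ∀ i j x, True → x.1 u = x.1 v → (mergeStep g s i j x).1 u = (mergeStep g s i j x).1 v :=
    fun i j x _ hx => mergeStep_class hx
  have h₂ : x.1 u = x.1 v := by
    refine List.foldr_establishes (I := fun _ => True) (Q := fun x : (Fin n → Fin n) × (Fin n → Bool) => x.1 u = x.1 v) (i := u)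
      (fun _ _ _ => trivial) (fun i x _ hx => List.foldr_invariant 
        (I := fun x : (Fin n → Fin n) × (Fin n → Bool) => x.1 u = x.1 v)
        (fun j x hx => mergeStep_class hx) hx _) (fun x _ => ?_) trivial (List.mem_finRange u)
    exact List.foldr_establishes (I := fun _ => True) (Q := fun x : (Fin n → Fin n) × (Fin n → Bool) => x.1 u = x.1 v) (i := v)
      (fun _ _ _ => trivial) (hQ u) (fun x _ => mergeStep_edge hu hv huv x) trivial
      (List.mem_finRange v)
  exact fun h => hc u v hu hv huv ((h₁ u v h₂).1 h)

end Coloring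

/-! ### Correctness of the auction. -/

section Auction

variable {n : ℕ} {e : Fin n → Fin n → Bool}

/-- The invariants of the auction: owners are neighbours, own one vertex each, and paid at most one
more than the least price of a neighbour. -/
structure AuctionInvariant (e : Fin n → Fin n → Bool) (x : AuctionState n) : Prop where
  edge : ∀ u v, x.2 v = some u → e u v = true
  inj : ∀ u v w, x.2 v = some u → x.2 w = some u → v = w
  free : ∀ v, x.2 v = none → (x.1 v).val = 0
  cheap : ∀ u v w, x.2 v = some u → e u w = true → (x.1 v).val ≤ (x.1 w).val + 1

theorem isSome_and_getD_iff {o : Option (Fin n)} {u : Fin n} :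
    (o.isSome && o.getD u == u) = true ↔ o = some u := by
  cases o <;> simp

theorem wants_iff {x : AuctionState n} {u v : Fin n} : wants e x u v = true ↔
    e u v = true ∧ (∀ w, x.2 w ≠ some u) ∧ (x.1 v).val ≤ n ∧
      ∀ w, e u w = true → (x.1 v).val ≤ (x.1 w).val := by
  simp only [wants, Bool.and_eq_true (e u v), Bool.and_eq_true (!_), Bool.and_eq_true (decide _),
    isSome_and_getD_iff, Bool.not_eq_true', decide_eq_false_iff_not, decide_eq_true_eq,
    not_exists, Bool.and_eq_true (e u _), not_and, not_not]

theorem Level.val_succ {n : ℕ} {p : Level n} (h : p.val ≤ n) : p.succ.val = p.val + 1 := by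
  simp [Level.succ, h]

/-- The new owner pays one more than the least price among its neighbours, and prices never fall, so
`cheap` persists; a displaced owner is merely left with nothing. -/
theorem AuctionInvariant.bid (u v : Fin n) {x : AuctionState n} (hx : AuctionInvariant e x) :
    AuctionInvariant e (bid e u v x) := by
  unfold _root_.bid
  split_ifs with h
  · obtain ⟨huv, hu, hv, hmin⟩ := wants_iff.1 h
    have hs := Level.val_succ hv
    have hp : ∀ w, (x.1 w).val ≤ (if (w == v) = true then (x.1 w).succ else x.1 w).val := by
      intro w
      split_ifs with hw
      · rw [beq_iff_eq] at hw; subst hw; omega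
      · exact le_rfl
    refine ⟨fun a b hab => ?_, fun a b d hb hd => ?_, fun b hb => ?_, fun a b d hab had => ?_⟩
    · dsimp only at hab
      split_ifs at hab with h₁
      · rw [beq_iff_eq] at h₁; cases hab; exact h₁ ▸ huv
      · exact hx.edge a b hab
    · dsimp only at hb hd
      split_ifs at hb hd with h₁ h₂ h₂
      · rw [beq_iff_eq] at h₁ h₂; rw [h₁, h₂]
      · cases hb; exact absurd hd (hu d)
      · cases hd; exact absurd hb (hu b)
      · exact hx.inj a b d hb hd
    · dsimp only at hb ⊢
      split_ifs at hb ⊢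
      exact hx.free b hb
    · dsimp only at hab ⊢
      refine le_trans ?_ (Nat.succ_le_succ (hp d))
      split_ifs at hab ⊢ with h₁
      · rw [beq_iff_eq] at h₁; cases hab; subst h₁
        have := hmin d had
        omega
      · exact hx.cheap a b d hab had
  · exact hx

theorem bid_eq_or_lt (u v : Fin n) (x : AuctionState n) :
    (bid e u v x = x ∧ wants e x u v = false) ∨
      ∑ w, (x.1 w).val < ∑ w, ((bid e u v x).1 w).val := by
  unfold bid
  split_ifs with h
  · right
    have hs := Level.val_succ (wants_iff.1 h).2.2.1
    refine Finset.sum_lt_sum (fun w _ => ?_) ⟨v, Finset.mem_univ v, ?_⟩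
    · dsimp only
      split_ifs with hw
      · rw [beq_iff_eq] at hw; subst hw; omega
      · exact le_rfl
    · simp [hs]
  · simpa using h

/-- A round that does not raise the total price has offered every pair a bid in the unchanged state,
and each was declined. -/
theorem biddingRound_eq_or_lt (x : AuctionState n) :
    (biddingRound e x = x ∧ ∀ u v, wants e x u v = false) ∨
      ∑ w, (x.1 w).val < ∑ w, ((biddingRound e x).1 w).val := by
  have inner : ∀ (u : Fin n) (x : AuctionState n), _ :=
    fun u x => List.foldr_eq_or_lt (f := fun v x => bid e u v x)
      (Φ := fun x : AuctionState n => ∑ w, (x.1 w).val)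
      (fun v x => (bid_eq_or_lt u v x).imp_left And.left) x (List.finRange n)
  rcases List.foldr_eq_or_lt (Φ := fun x : AuctionState n => ∑ w, (x.1 w).val)
    (fun u x => (inner u x).imp_left And.left) x (List.finRange n) with ⟨h₁, h₂⟩ | h
  · refine .inl ⟨h₁, fun u v => ?_⟩
    rcases inner u x with ⟨-, h₃⟩ | h₃
    · rcases bid_eq_or_lt (e := e) u v x with h | h
      · exact h.2
      · rw [h₃ v (List.mem_finRange v)] at h
        exact absurd h (lt_irrefl _)
    · rw [h₂ u (List.mem_finRange u)] at h₃
      exact absurd h₃ (lt_irrefl _)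
  · exact .inr h

theorem auction_eq : auction e = (biddingRound e)^[(n + 1) * n]
    (fun _ => ⟨0, by omega⟩, fun _ => none) := by
  rw [Function.iterate_mul]
  rfl

theorem auctionInvariant_auction : AuctionInvariant e (auction e) := by
  rw [auction_eq]
  refine Function.Iterate.rec (AuctionInvariant e) ?_ (fun x hx => ?_) _
  · exact ⟨by simp, by simp, by simp, by simp⟩
  · exact List.foldr_invariant (fun u x hx => List.foldr_invariant (fun v x hx => hx.bid u v) hx _)
      hx _

theorem not_wants_auction (u v : Fin n) : wants e (auction e) u v = false := by
  have h := Function.iterate_isFixedPt_of_bounded (f := biddingRound e) (m := (n + 1) * n)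
    (Φ := fun x : AuctionState n => ∑ w, (x.1 w).val)
    (fun x => (biddingRound_eq_or_lt x).imp_left And.left)
    (fun x => (Finset.sum_le_card_nsmul _ _ (n + 1) fun w _ => by
      have := (x.1 w).lt; omega).trans (by simp [mul_comm])) (fun _ => ⟨0, by omega⟩, fun _ => none)
  rw [← auction_eq] at h
  rcases biddingRound_eq_or_lt (e := e) (auction e) with h' | h'
  · exact h'.2 u v
  · rw [h] at h'
    exact absurd h' (lt_irrefl _)

/-- Pigeonhole: `n` vertices cannot occupy all `n + 1` levels `0, …, n`. The fold inspects the
levels below `n` and falls back on `n`. -/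
theorem priceGap_spec (x : AuctionState n) :
    (priceGap x).val ≤ n ∧ ∀ v, (x.1 v).val ≠ (priceGap x).val := by
  have key : ∀ l : List (Fin n), ∀ p : Level n, p = l.foldr
      (fun i p => if decide (∃ v, decide ((x.1 v).val = i.val) = true) = true then p
      else ⟨i.val, by omega⟩) ⟨n, by omega⟩ →
      (p.val < n ∧ ∀ v, (x.1 v).val ≠ p.val) ∨
        (p.val = n ∧ ∀ i ∈ l, ∃ v, (x.1 v).val = i.val) := by
    intro l
    induction l with
    | nil => rintro p rfl; simp
    | cons i l ih =>
      rintro p rfl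
      rw [List.foldr_cons]
      split_ifs with h
      · rcases ih _ rfl with h' | h'
        · exact .inl h'
        · refine .inr ⟨h'.1, ?_⟩
          simp only [decide_eq_true_eq] at h
          simpa using ⟨h, h'.2⟩
      · simp only [decide_eq_true_eq, not_exists] at h
        exact .inl ⟨i.2, h⟩
  rcases key _ (priceGap x) rfl with h | ⟨h₁, h₂⟩
  · exact ⟨h.1.le, h.2⟩
  · refine ⟨h₁.le, fun v hv => ?_⟩
    have hall : ∀ i : Fin (n + 1), ∃ w, (x.1 w).val = i.val := by
      intro i
      rcases Nat.lt_succ_iff_lt_or_eq.1 i.2 with h | h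
      · exact h₂ ⟨i, h⟩ (List.mem_finRange _)
      · exact ⟨v, by rw [hv, h₁, h]⟩
    choose f hf using hall
    have hinj : Function.Injective f := fun i j hij =>
      Fin.ext (by rw [← hf i, ← hf j, hij])
    simpa using Fintype.card_le_of_injective f hinj

theorem leftCover_iff {x : AuctionState n} {u : Fin n} :
    leftCover x u = true ↔ ∃ v, x.2 v = some u ∧ (x.1 v).val < (priceGap x).val := by
  simp only [leftCover, decide_eq_true_eq, Bool.and_eq_true _ (!_), isSome_and_getD_iff,
    Bool.not_eq_true', decide_eq_false_iff_not, not_le]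

theorem rightCover_iff {x : AuctionState n} {v : Fin n} :
    rightCover x v = true ↔ (priceGap x).val < (x.1 v).val := by
  simp [rightCover]

/-- Let `p` be the gap. If `u` owns `w` at a price not below `p`, that price exceeds `p`, so `v`
costs at least `p` by `cheap`, hence more than `p`. If `u` owns nothing, it has been priced out: all
its neighbours cost more than `n ≥ p`. -/
theorem auction_isCover {u v : Fin n} (huv : e u v = true) :
    leftCover (auction e) u = true ∨ rightCover (auction e) v = true := by
  rw [leftCover_iff, rightCover_iff]
  obtain ⟨hp, hgap⟩ := priceGap_spec (auction e)
  by_cases hu : ∃ w, (auction e).2 w = some u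
  · obtain ⟨w, hw⟩ := hu
    have h₁ := auctionInvariant_auction.cheap u w v hw huv
    have h₂ := hgap w
    have h₃ := hgap v
    by_cases h : ((auction e).1 w).val < (priceGap (auction e)).val
    · exact .inl ⟨w, hw, h⟩
    · right; omega
  · right
    obtain ⟨w, hw, hmin⟩ := Finset.exists_min_image (Finset.univ.filter fun w => e u w = true)
      (fun w => ((auction e).1 w).val) ⟨v, by simpa using huv⟩
    have h := not_wants_auction (e := e) u w
    rw [← Bool.not_eq_true, wants_iff] at h
    push Not at hu h
    obtain ⟨d, hd, hlt⟩ | hn : (∃ d, e u d = true ∧ _) ∨ n < ((auction e).1 w).val := by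
      by_cases hn : ((auction e).1 w).val ≤ n
      · exact .inl (h (by simpa using hw) hu hn)
      · exact .inr (by omega)
    · exact absurd (hmin d (by simpa using hd)) (not_le.2 hlt)
    · have := hmin v (by simpa using huv)
      omega

/-- Ownership is a matching, with right ends `M`. The auction's cover uses at most one end of each
matching edge: the left end when the price is below the gap, the right end when it is above (a
positive price implies an owner). Any cover `l`, `r` needs at least one end of each. -/
theorem auction_cover_le {l r : Fin n → Bool}
    (h : ∀ u v, e u v = true → l u = true ∨ r v = true) :
    countTrue (leftCover (auction e)) + countTrue (rightCover (auction e))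
      ≤ countTrue l + countTrue r := by
  classical
  have hI := auctionInvariant_auction (e := e)
  set x := auction e with hx
  simp only [countTrue_eq_card]
  set M := Finset.univ.filter fun v => x.2 v ≠ none with hM
  have h₁ : (Finset.univ.filter fun u => leftCover x u = true).card
      ≤ (M.filter fun v => (x.1 v).val < (priceGap x).val).card := by
    refine le_trans (Finset.card_le_card fun u hu => ?_)
      -- This map sends a right vertex to its owner; the default `v` is never used on `M`.
      (Finset.card_image_le (f := fun v => (x.2 v).getD v))
    obtain ⟨v, hv, hlt⟩ := leftCover_iff.1 (Finset.mem_filter.1 hu).2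
    exact Finset.mem_image.2 ⟨v, by simp [hM, hv, hlt], by simp [hv]⟩
  have h₂ : (Finset.univ.filter fun v => rightCover x v = true).card
      ≤ (M.filter fun v => ¬ (x.1 v).val < (priceGap x).val).card := by
    refine Finset.card_le_card fun v hv => ?_
    have hlt := rightCover_iff.1 (Finset.mem_filter.1 hv).2
    have : x.2 v ≠ none := fun h => by have := hI.free v h; omega
    simp only [hM, Finset.mem_filter, Finset.mem_univ, true_and]
    exact ⟨this, by omega⟩
  have h₃ : (M.filter fun v => ¬ r v = true).card
      ≤ (Finset.univ.filter fun u => l u = true).card := by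
    refine Finset.card_le_card_of_injOn (fun v => (x.2 v).getD v) (fun v hv => ?_)
      fun v hv w hw hvw => ?_
    · simp only [hM, Finset.coe_filter, Finset.mem_filter, Finset.mem_univ, true_and,
        Set.mem_ofPred_eq] at hv ⊢
      obtain ⟨u, hu⟩ := Option.ne_none_iff_exists'.1 hv.1
      rw [hu]
      exact (h u v (hI.edge u v hu)).resolve_right hv.2
    · simp only [hM, Finset.coe_filter, Finset.mem_filter, Finset.mem_univ, true_and,
        Set.mem_ofPred_eq] at hv hw hvw
      obtain ⟨u, hu⟩ := Option.ne_none_iff_exists'.1 hv.1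
      obtain ⟨u', hu'⟩ := Option.ne_none_iff_exists'.1 hw.1
      rw [hu, hu'] at hvw
      simp only [Option.getD_some] at hvw
      exact hI.inj u v w hu (hvw ▸ hu')
  have h₄ : (M.filter fun v => r v = true).card ≤ (Finset.univ.filter fun v => r v = true).card :=
    Finset.card_le_card (Finset.filter_subset_filter _ (Finset.subset_univ _))
  have h₅ := Finset.card_filter_add_card_filter_not (s := M)
    (fun v => (x.1 v).val < (priceGap x).val)
  have h₆ := Finset.card_filter_add_card_filter_not (s := M) (fun v => r v = true)
  omega

end Auction

/-! ### Correctness of the search through partial colourings. -/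

section Search

variable {n : ℕ} {g : Fin n → Fin n → Bool} {s φ : Fin n → Bool} {σ : Fin n → Option Bool}

theorem hasColor_iff {v : Fin n} {b : Bool} : hasColor σ v b = true ↔ σ v = some b := by
  unfold hasColor
  cases σ v <;> simp

theorem forbidden_iff {v : Fin n} {b : Bool} :
    forbidden g σ v b = true ↔ ∃ w, g v w = true ∧ σ w = some b := by
  simp [forbidden, hasColor_iff]

theorem conflict_iff : conflict g σ = true ↔ ∃ v w b, g v w = true ∧ σ v = some b ∧ σ w = some b := by
  simp only [conflict, decide_eq_true_eq, Bool.or_eq_true, Bool.and_eq_true, hasColor_iff,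
    forbidden_iff]
  constructor
  · rintro ⟨v, ⟨h, w, h₁, h₂⟩ | ⟨h, w, h₁, h₂⟩⟩ <;> exact ⟨v, w, _, h₁, h, h₂⟩
  · rintro ⟨v, w, _ | _, h₁, h, h₂⟩
    · exact ⟨v, .inr ⟨h, w, h₁, h₂⟩⟩
    · exact ⟨v, .inl ⟨h, w, h₁, h₂⟩⟩

theorem coverGraph_iff {u v : Fin n} : coverGraph g s φ σ u v = true ↔
    (u = v ∨ g u v = true) ∧ s u = false ∧ s v = false ∧ forbidden g σ u (φ u) = false ∧
      forbidden g σ v (!φ v) = false := by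
  simp only [coverGraph, Bool.and_eq_true, Bool.or_eq_true, beq_iff_eq, Bool.not_eq_true',
    and_assoc]

/-- The set computed from `σ` is an odd cycle transversal. -/
theorem exists_properOff_candidate (hg : ∀ u v, g u v = g v u) (hφ : ProperOff g s φ)
    (hσ : conflict g σ = false) :
    ∃ c, ProperOff g (candidate g s φ σ (auction (coverGraph g s φ σ))) c := by
  set x := auction (coverGraph g s φ σ) with hx
  have hcov : ∀ u v, coverGraph g s φ σ u v = true → leftCover x u = true ∨ rightCover x v = true :=
    fun u v => auction_isCover
  -- Outside `s`, a surviving vertex takes the colour of a copy that is neither forced nor in the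
  -- cover. The default `false` concerns deleted vertices only.
  let c : Fin n → Bool := fun v => if s v = true then (σ v).getD false
    else if (forbidden g σ v (φ v) || leftCover x v) = true then !φ v else φ v
  have hs : ∀ v, s v = true → candidate g s φ σ x v = false → σ v = some (c v) := by
    intro v hv hc
    simp only [candidate, hv, if_true, c] at hc ⊢
    cases h : σ v <;> simp_all
  have hf : ∀ v, s v = false → candidate g s φ σ x v = false → forbidden g σ v (c v) = false := by
    intro v hv hc
    simp only [candidate, hv, Bool.false_eq_true, if_false, c] at hc ⊢
    split_ifs with h
    · simp_all
    · simp_all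
  have hr : ∀ v, s v = false → candidate g s φ σ x v = false → c v = (!φ v) →
      rightCover x v = false := by
    intro v hv hc h
    simp only [candidate, hv, Bool.false_eq_true, if_false, c] at hc h
    split_ifs at h with h'
    · simp_all
    · cases φ v <;> simp at h
  have hl : ∀ v, s v = false → c v = φ v → leftCover x v = false := by
    intro v hv h
    simp only [hv, Bool.false_eq_true, if_false, c] at h
    split_ifs at h with h'
    · cases φ v <;> simp at h
    · simp_all
  -- On an edge outside `s` the colours under `φ` differ, so equal colours under `c` mean that
  -- exactly one end departs from `φ`. The two copies left out would then be adjacent in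
  -- `coverGraph`.
  have key : ∀ u v, s u = false → s v = false → candidate g s φ σ x u = false →
      candidate g s φ σ x v = false → g u v = true → c u = φ u → c v = (!φ v) → False := by
    intro u v hu hv hcu hcv huv h₁ h₂
    have h₃ := hf u hu hcu
    have h₄ := hf v hv hcv
    rw [h₁] at h₃
    rw [h₂] at h₄
    rcases hcov u v (coverGraph_iff.2 ⟨.inr huv, hu, hv, h₃, h₄⟩) with h | h
    · rw [hl u hu h₁] at h; cases h
    · rw [hr v hv hcv h₂] at h; cases h
  have mixed : ∀ u v, s u = false → s v = true → candidate g s φ σ x u = false →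
      candidate g s φ σ x v = false → g u v = true → c u ≠ c v := by
    intro u v hu hv hcu hcv huv h
    have := hf u hu hcu
    rw [← Bool.not_eq_true, forbidden_iff] at this
    exact this ⟨v, huv, h ▸ hs v hv hcv⟩
  refine ⟨c, fun u v hu hv huv => ?_⟩
  cases hsu : s u <;> cases hsv : s v
  · intro h
    have hne := hφ u v hsu hsv huv
    by_cases h₁ : c u = φ u
    · exact key u v hsu hsv hu hv huv h₁ (by rw [← h, h₁]; exact Bool.eq_not_of_ne hne)
    · have h₁ := Bool.eq_not_of_ne h₁
      refine key v u hsv hsu hv hu (hg u v ▸ huv) ?_ h₁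
      rw [← h, h₁, Bool.eq_not_of_ne hne, Bool.not_not]
  · exact mixed u v hsu hsv hu hv huv
  · exact (mixed v u hsv hsu hv hu (hg u v ▸ huv)).symm
  · intro h
    rw [← Bool.not_eq_true, conflict_iff] at hσ
    exact hσ ⟨u, v, c u, huv, hs u hsu hu, h ▸ hs v hsv hv⟩

/-- The set computed from the restriction to `s` of a 2-colouring outside `z` is not larger than
`z`. -/
theorem countTrue_candidate_le {z c : Fin n → Bool} (hφ : ProperOff g s φ) (hz : ProperOff g z c)
    (hσ : ∀ v, σ v = if s v = true ∧ z v = false then some (c v) else none) :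
    countTrue (candidate g s φ σ (auction (coverGraph g s φ σ))) ≤ countTrue z := by
  set x := auction (coverGraph g s φ σ) with hx
  -- The competing cover read off from `z` and `c`: among the unforced copies, those of vertices of
  -- `z` and those whose layer is not the colour under `c`.
  let l : Fin n → Bool := fun v => !s v && !forbidden g σ v (φ v) && (z v || c v != φ v)
  let r : Fin n → Bool := fun v => !s v && !forbidden g σ v (!φ v) && (z v || c v == φ v)
  have hle := auction_cover_le (e := coverGraph g s φ σ) (l := l) (r := r) fun u v huv => by
    obtain ⟨h, hu, hv, hfu, hfv⟩ := coverGraph_iff.1 huv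
    simp only [l, r, hu, hv, hfu, hfv, Bool.not_false, Bool.true_and]
    rcases h with rfl | h
    · cases z u <;> cases c u <;> cases φ u <;> simp
    · have h₁ := hz u v
      have h₂ := hφ u v hu hv h
      revert h₁ h₂
      cases z u <;> cases z v <;> cases c u <;> cases φ u <;> cases c v <;> cases φ v <;> simp [h]
  rw [← hx] at hle
  have hcov : ∀ v, s v = false → forbidden g σ v (φ v) = false → forbidden g σ v (!φ v) = false →
      leftCover x v = true ∨ rightCover x v = true :=
    fun v hv h₁ h₂ => auction_isCover (coverGraph_iff.2 ⟨.inl rfl, hv, hv, h₁, h₂⟩)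
  have hfree : ∀ v, s v = false → z v = false → forbidden g σ v (c v) = false := by
    intro v hv hzv
    rw [← Bool.not_eq_true, forbidden_iff]
    rintro ⟨w, hvw, hw⟩
    rw [hσ] at hw
    split_ifs at hw with h
    exact hz v w hzv h.2 hvw (Option.some.inj hw).symm
  simp only [countTrue_eq_sum] at hle ⊢
  -- Outside `s`, at least one copy is forced or covered, and both are for a deleted vertex. On `s`,
  -- the deleted vertices are those of `z`.
  have h₁ : ∀ v, (candidate g s φ σ x v).toNat + (!s v).toNat ≤ (s v && z v).toNat +
      (!s v && forbidden g σ v (φ v)).toNat + (!s v && forbidden g σ v (!φ v)).toNat +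
      (leftCover x v).toNat + (rightCover x v).toNat := by
    intro v
    have h := hcov v
    have h' := hσ v
    simp only [candidate]
    revert h h'
    cases s v
    · cases forbidden g σ v (φ v) <;> cases forbidden g σ v (!φ v) <;> cases leftCover x v <;>
        cases rightCover x v <;> simp
    · intro _ h'
      rw [h']
      cases z v <;> simp
      omega
  -- For the competing cover the count is exact: outside `s`, one copy off `z` and two copies on
  -- `z`, because by `hfree` the copy `(v, c v)` is not forced.
  have h₂ : ∀ v, (!s v && forbidden g σ v (φ v)).toNat + (!s v && forbidden g σ v (!φ v)).toNat +
      (l v).toNat + (r v).toNat ≤ (!s v).toNat + (!s v && z v).toNat := by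
    intro v
    have h := hfree v
    simp only [l, r]
    revert h
    cases s v
    · cases z v
      · cases c v <;> cases φ v <;> simp only [Bool.not_false, Bool.not_true] <;>
          generalize forbidden g σ v false = p <;> generalize forbidden g σ v true = q <;>
          cases p <;> cases q <;> simp
      · cases forbidden g σ v (φ v) <;> cases forbidden g σ v (!φ v) <;> simp
    · simp
  have h₃ : ∀ v, (s v && z v).toNat + (!s v && z v).toNat = (z v).toNat := by
    intro v
    cases s v <;> simp
  have h₁ := Finset.sum_le_sum fun v (_ : v ∈ Finset.univ) => h₁ v
  have h₂ := Finset.sum_le_sum fun v (_ : v ∈ Finset.univ) => h₂ v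
  have h₃ := Finset.sum_congr (rfl : Finset.univ = Finset.univ) fun v (_ : v ∈ _) => h₃ v
  simp only [Finset.sum_add_distrib] at h₁ h₂ h₃
  omega

theorem conflict_restrict {z c : Fin n → Bool} (hz : ProperOff g z c)
    (hσ : ∀ v, σ v = if s v = true ∧ z v = false then some (c v) else none) :
    conflict g σ = false := by
  rw [← Bool.not_eq_true, conflict_iff]
  rintro ⟨v, w, b, hvw, hv, hw⟩
  rw [hσ] at hv hw
  split_ifs at hv hw with h₁ h₂
  exact hz v w h₁.2 h₂.2 hvw ((Option.some.inj hv).trans (Option.some.inj hw).symm)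

theorem mem_expandAt {i : Fin n} {l : List (Fin n → Option Bool)} {ρ : Fin n → Option Bool} :
    ρ ∈ expandAt i l ↔ ∃ σ ∈ l, ρ = σ ∨ ∃ b, ρ = fun w => if (w == i) = true then some b else σ w := by
  have : ∀ m : List (Fin n → Option Bool), ρ ∈ l.foldl (fun l σ =>
      σ :: (fun w => if (w == i) = true then some true else σ w) ::
        (fun w => if (w == i) = true then some false else σ w) :: l) m ↔
      (∃ σ ∈ l, ρ = σ ∨ ∃ b, ρ = fun w => if (w == i) = true then some b else σ w) ∨ ρ ∈ m := by
    induction l with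
    | nil => simp
    | cons σ l ih =>
      intro m
      rw [List.foldl_cons, ih]
      simp only [List.mem_cons, exists_eq_or_imp, Bool.exists_bool]
      have h : ∀ p q r t k : Prop, (k ∨ p ∨ q ∨ r ∨ t) ↔ ((p ∨ r ∨ q) ∨ k) ∨ t := by tauto
      exact h _ _ _ _ _
  refine (this []).trans ?_
  simp

theorem mem_partialColorings (hσ : ∀ v, s v = false → σ v = none) : σ ∈ partialColorings s := by
  have : ∀ (l : List (Fin n)) (σ : Fin n → Option Bool), (∀ v, s v = false ∨ v ∉ l → σ v = none) →
      σ ∈ l.foldr (fun i l => if s i = true then expandAt i l else l) [fun _ => none] := by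
    intro l
    induction l with
    | nil => exact fun σ h => List.mem_singleton.2 (funext fun v => h v (.inr (by simp)))
    | cons i l ih =>
      intro σ h
      rw [List.foldr_cons]
      split_ifs with hi
      · rw [mem_expandAt]
        cases hσi : σ i with
        | none =>
          refine ⟨σ, ih σ fun v hv => ?_, .inl rfl⟩
          by_cases hvi : v = i
          · rw [hvi, hσi]
          · exact h v (hv.imp_right fun hv => by simp [hvi, hv])
        | some b =>
          refine ⟨fun w => if w = i then none else σ w, ih _ fun v hv => ?_, .inr ⟨b, ?_⟩⟩
          · split_ifs with hvi
            · rfl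
            · exact h v (hv.imp_right fun hv => by simp [hvi, hv])
          · funext w
            by_cases hw : w = i
            · simp [hw, hσi]
            · simp [hw]
      · refine ih σ fun v hv => ?_
        by_cases hvi : v = i
        · exact h v (.inl (by rw [hvi]; simpa using hi))
        · exact h v (hv.imp_right fun hv => by simp [hvi, hv])
  exact this _ _ fun v hv => hσ v (hv.resolve_right fun h => h (List.mem_finRange v))

/-- For a transversal `z` with colouring `c`, the restriction of `c` to `s` minus `z` is on the
list, and its candidate is not larger than `z`. Hence the best candidate is a global minimum. -/
theorem bestTransversal_spec (hg : ∀ u v, g u v = g v u) (hs : ∃ c, ProperOff g s c) :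
    (∃ c, ProperOff g (bestTransversal g s) c) ∧
      ∀ z c, ProperOff g z c → countTrue (bestTransversal g s) ≤ countTrue z := by
  obtain ⟨c₀, hc₀⟩ := hs
  have hφ := properOff_twoColoring hc₀
  set φ := twoColoring g s with hφ'
  have key : ∀ (l : List (Fin n → Option Bool)) (y : Fin n → Bool), (∃ c, ProperOff g y c) →
      (∃ c, ProperOff g (l.foldl (improve g s φ) y) c) ∧
        countTrue (l.foldl (improve g s φ) y) ≤ countTrue y ∧
        ∀ σ ∈ l, conflict g σ = false → countTrue (l.foldl (improve g s φ) y) ≤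
          countTrue (candidate g s φ σ (auction (coverGraph g s φ σ))) := by
    intro l
    induction l with
    | nil => exact fun y hy => ⟨hy, le_rfl, by simp⟩
    | cons σ l ih =>
      intro y hy
      have h₁ : (∃ c, ProperOff g (improve g s φ y σ) c) ∧
          countTrue (improve g s φ y σ) ≤ countTrue y ∧
          (conflict g σ = false → countTrue (improve g s φ y σ) ≤
            countTrue (candidate g s φ σ (auction (coverGraph g s φ σ)))) := by
        unfold improve
        split_ifs with h h'
        · exact ⟨hy, le_rfl, by simp [h]⟩
        · exact ⟨hy, le_rfl, fun _ => of_decide_eq_true h'⟩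
        · simp only [decide_eq_true_eq, not_le] at h'
          exact ⟨exists_properOff_candidate hg hφ (by simpa using h), h'.le, fun _ => le_rfl⟩
      obtain ⟨h₂, h₃, h₄⟩ := ih _ h₁.1
      refine ⟨h₂, h₃.trans h₁.2.1, fun ρ hρ hc => ?_⟩
      rcases List.mem_cons.1 hρ with rfl | hρ
      · exact h₃.trans (h₁.2.2 hc)
      · exact h₄ ρ hρ hc
  obtain ⟨h₁, -, h₃⟩ := key (partialColorings s) s ⟨c₀, hc₀⟩
  refine ⟨h₁, fun z c hz => ?_⟩
  let σ : Fin n → Option Bool := fun v => if s v = true ∧ z v = false then some (c v) else none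
  exact (h₃ σ (mem_partialColorings fun v hv => by simp [σ, hv])
    (conflict_restrict hz fun _ => rfl)).trans (countTrue_candidate_le hφ hz fun _ => rfl)

theorem compressStep_eq_none (hg : ∀ u v, g u v = g v u) (hs : ∃ c, ProperOff g s c)
    (h : compressStep g s = none) {z c : Fin n → Bool} (hz : ProperOff g z c) :
    countTrue s ≤ countTrue z := by
  unfold compressStep at h
  split_ifs at h with h'
  exact (of_decide_eq_true h').trans ((bestTransversal_spec hg hs).2 z c hz)

theorem compressStep_eq_some (hg : ∀ u v, g u v = g v u) (hs : ∃ c, ProperOff g s c)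
    {y : Fin n → Bool} (h : compressStep g s = some y) :
    (∃ c, ProperOff g y c) ∧ countTrue y < countTrue s ∧
      ∀ z c, ProperOff g z c → countTrue y ≤ countTrue z := by
  unfold compressStep at h
  split_ifs at h with h'
  cases h
  simp only [decide_eq_true_eq, not_le] at h'
  exact ⟨(bestTransversal_spec hg hs).1, h', (bestTransversal_spec hg hs).2⟩

end Search

/-! ### Colourings of induced subgraphs -/

section ColorableOn

variable {V : Type*}

/-- The subgraph of `G` induced on `A` has a proper 2-colouring. -/
def ColorableOn (G : SimpleGraph V) (A : Finset V) : Prop :=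
  ∃ c : V → Bool, ∀ u ∈ A, ∀ v ∈ A, G.Adj u v → c u ≠ c v

theorem ColorableOn.mono {G : SimpleGraph V} {A B : Finset V} (h : ColorableOn G B) (hAB : A ⊆ B) :
    ColorableOn G A :=
  let ⟨c, hc⟩ := h
  ⟨c, fun u hu v hv => hc u (hAB hu) v (hAB hv)⟩

/-- Colourings defined on all of `V`, with irrelevant values on `S`, avoid subtypes from here on. -/
theorem isOCT_iff {G : SimpleGraph V} {S : Finset V} :
    IsOCT G S ↔ ∃ c : V → Bool, ∀ u v, u ∉ S → v ∉ S → G.Adj u v → c u ≠ c v := by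
  classical
  constructor
  · rintro ⟨C⟩
    refine ⟨fun v => if h : v ∉ S then decide (C ⟨v, h⟩ = 0) else false, fun u v hu hv huv => ?_⟩
    have hne : C ⟨u, hu⟩ ≠ C ⟨v, hv⟩ := C.valid huv
    simp only [hu, hv, not_false_eq_true, dif_pos]
    revert hne
    generalize C ⟨u, hu⟩ = a
    generalize C ⟨v, hv⟩ = b
    revert a b
    decide
  · rintro ⟨c, hc⟩
    refine ⟨SimpleGraph.Coloring.mk (fun x => if c x.1 = true then 0 else 1) fun {x y} hxy => ?_⟩
    have hne := hc x.1 y.1 x.2 y.2 hxy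
    revert hne
    cases c x.1 <;> cases c y.1 <;> simp

theorem mem_liftFrom {A : Finset V} {X : Finset {v // v ∈ A}} {v : V} :
    v ∈ liftFrom X ↔ ∃ h : v ∈ A, ⟨v, h⟩ ∈ X := by
  simp [liftFrom]

theorem card_liftFrom {A : Finset V} (X : Finset {v // v ∈ A}) : (liftFrom X).card = X.card :=
  Finset.card_map _

theorem liftFrom_subset {A : Finset V} (X : Finset {v // v ∈ A}) : liftFrom X ⊆ A :=
  fun _ hv => (mem_liftFrom.1 hv).1

variable [DecidableEq V]

theorem mem_restrictTo {A X : Finset V} {v : {v // v ∈ A}} : v ∈ restrictTo A X ↔ v.1 ∈ X := by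
  simp [restrictTo]

theorem liftFrom_restrictTo {A X : Finset V} (h : X ⊆ A) : liftFrom (restrictTo A X) = X := by
  ext v
  simp only [mem_liftFrom, mem_restrictTo, exists_prop, and_iff_right_iff_imp]
  exact fun hv => h hv

theorem card_restrictTo {A X : Finset V} (h : X ⊆ A) : (restrictTo A X).card = X.card := by
  rw [← card_liftFrom, liftFrom_restrictTo h]

theorem isOCT_iff_colorableOn [Fintype V] {G : SimpleGraph V} {S : Finset V} :
    IsOCT G S ↔ ColorableOn G Sᶜ := by
  simp only [isOCT_iff, ColorableOn, Finset.mem_compl]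
  exact exists_congr fun c => ⟨fun h u hu v hv => h u v hu hv, fun h u v hu hv => h u hu v hv⟩

theorem isOCT_inducedOn_iff {G : SimpleGraph V} {A : Finset V} {X : Finset {v // v ∈ A}} :
    IsOCT (inducedOn G A) X ↔ ColorableOn G (A \ liftFrom X) := by
  rw [isOCT_iff]
  constructor
  · rintro ⟨c, hc⟩
    refine ⟨fun v => if h : v ∈ A then c ⟨v, h⟩ else false, fun u hu v hv huv => ?_⟩
    simp only [Finset.mem_sdiff, mem_liftFrom, not_exists] at hu hv
    simp only [hu.1, hv.1, dif_pos]
    exact hc _ _ (hu.2 hu.1) (hv.2 hv.1) huv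
  · rintro ⟨c, hc⟩
    refine ⟨fun v => c v.1, fun u v hu hv huv => hc _ ?_ _ ?_ huv⟩ <;>
      simpa [Finset.mem_sdiff, mem_liftFrom]

end ColorableOn

/-! ### The disjoint compression algorithm -/

theorem isVertexCoverOn_iff {α : Type*} {K : SimpleGraph α} {U C : Finset α} :
    IsVertexCoverOn K U C ↔ C ⊆ U ∧ ∀ x ∈ U, ∀ y ∈ U, K.Adj x y → x ∈ C ∨ y ∈ C :=
  and_congr_right fun _ => ⟨fun h x hx y hy hxy => @h ⟨x, hx⟩ ⟨y, hy⟩ hxy,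
    fun h x y hxy => h x.1 x.2 y.1 y.2 hxy⟩

theorem exists_isMinVertexCoverOn {α : Type*} (K : SimpleGraph α) (U : Finset α) :
    ∃ C, IsMinVertexCoverOn K U C := by
  classical
  obtain ⟨C, hC, hmin⟩ := Finset.exists_min_image (U.powerset.filter (IsVertexCoverOn K U))
    Finset.card ⟨U, by simp [isVertexCoverOn_iff]; tauto⟩
  exact ⟨C, (Finset.mem_filter.1 hC).2, fun C' hC' =>
    hmin C' (Finset.mem_filter.2 ⟨Finset.mem_powerset.2 hC'.1, hC'⟩)⟩

theorem mem_bothLayers {W : Type*} {U : Finset W} {x : W × Bool} :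
    x ∈ bothLayers U ↔ x.1 ∈ U := by
  simp [bothLayers]

/-! ### Choices `Y` and the 2-colourings of `T`. -/

section Choice

variable {W : Type*} {H : SimpleGraph W} {T : Finset W}

/-- The choice that corresponds to a 2-colouring. -/
def choiceOf (T : Finset W) (c : W → Bool) : Finset (W × Bool) :=
  (bothLayers T).filter fun x => x.2 ≠ c x.1

theorem mem_choiceOf {c : W → Bool} {x : W × Bool} :
    x ∈ choiceOf T c ↔ x.1 ∈ T ∧ x.2 ≠ c x.1 := by
  simp [choiceOf, mem_bothLayers]

theorem isChoice_choiceOf (c : W → Bool) : IsChoice T (choiceOf T c) := by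
  refine ⟨Finset.filter_subset _ _, fun v hv => ?_⟩
  simp only [mem_choiceOf, hv, true_and]
  cases c v <;> simp

theorem isVertexCoverOn_choiceOf {c : W → Bool}
    (hc : ∀ u ∈ T, ∀ v ∈ T, H.Adj u v → c u ≠ c v) :
    IsVertexCoverOn (doubleGraph H) (bothLayers T) (choiceOf T c) := by
  refine isVertexCoverOn_iff.2 ⟨Finset.filter_subset _ _, fun x hx y hy hxy => ?_⟩
  rw [mem_bothLayers] at hx hy
  simp only [mem_choiceOf, hx, hy, true_and]
  by_contra! h
  rcases hxy with ⟨h₁, h₂⟩ | ⟨h₁, h₂⟩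
  · exact hc _ hx _ hy h₁ (by rw [← h.1, ← h.2, h₂])
  · exact h₂ (by rw [h.1, h.2, h₁])

variable [DecidableEq W]

theorem isChoice_iff {Y : Finset (W × Bool)} : IsChoice T Y ↔ ∃ U ⊆ T, Y = choiceOf T fun v => decide (v ∈ U) := by
  constructor
  · rintro ⟨h₁, h₂⟩
    refine ⟨T.filter fun v => (v, false) ∈ Y, Finset.filter_subset _ _, ?_⟩
    ext ⟨v, b⟩
    simp only [mem_choiceOf, Finset.mem_filter]
    by_cases hv : v ∈ T
    · have := h₂ v hv
      cases b <;> simp [hv]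
      tauto
    · simp only [hv, false_and, iff_false]
      exact fun h => hv (mem_bothLayers.1 (h₁ h))
  · rintro ⟨U, -, rfl⟩
    exact isChoice_choiceOf _

/-- A choice is determined by the set of those `v ∈ T` whose first copy it contains. -/
theorem length_choices {Ys : List (Finset (W × Bool))} (hn : Ys.Nodup)
    (hm : ∀ Y, Y ∈ Ys ↔ IsChoice T Y) : Ys.length = 2 ^ T.card := by
  rw [← Finset.card_powerset, ← List.toFinset_card_of_nodup hn]
  symm
  refine Finset.card_bij (fun U _ => choiceOf T fun v => decide (v ∈ U)) (fun U hU => ?_)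
    (fun U hU U' hU' h => ?_) fun Y hY => ?_
  · exact List.mem_toFinset.2 ((hm _).2 (isChoice_choiceOf _))
  · rw [Finset.mem_powerset] at hU hU'
    ext v
    have := congrArg ((v, false) ∈ ·) h
    simp only [mem_choiceOf, eq_iff_iff] at this
    have h₁ := @hU v
    have h₂ := @hU' v
    by_cases hv : v ∈ T
    · simpa [hv] using this
    · exact ⟨fun h => absurd (h₁ h) hv, fun h => absurd (h₂ h) hv⟩
  · obtain ⟨U, hU, rfl⟩ := isChoice_iff.1 ((hm Y).1 (List.mem_toFinset.1 hY))
    exact ⟨U, Finset.mem_powerset.2 hU, rfl⟩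

end Choice

section DisjointCompression

variable {W : Type*} [Fintype W] [DecidableEq W] {H : SimpleGraph W} {T : Finset W}
  {Y : Finset (W × Bool)}

theorem mem_forced {x : W × Bool} : x ∈ forced H T Y ↔
    x.1 ∉ T ∧ ∃ y, y.1 ∈ T ∧ y ∉ Y ∧ (doubleGraph H).Adj x y := by
  simp only [forced, Finset.mem_filter, mem_bothLayers, Finset.mem_compl, Finset.mem_sdiff]
  tauto

theorem mem_doubled {X : Finset (W × Bool)} {v : W} : v ∈ doubled X ↔ ∀ b, (v, b) ∈ X := by
  simp [doubled]

/-- The set computed by the body of the loop is a vertex cover of `H²`. -/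
theorem mem_or_mem_of_adj {Z : Finset (W × Bool)}
    (hY : IsVertexCoverOn (doubleGraph H) (bothLayers T) Y)
    (hZ : IsVertexCoverOn (doubleGraph H) (bothLayers Tᶜ \ forced H T Y) Z) {x y : W × Bool}
    (hxy : (doubleGraph H).Adj x y) : x ∈ Y ∪ forced H T Y ∪ Z ∨ y ∈ Y ∪ forced H T Y ∪ Z := by
  have hY := (isVertexCoverOn_iff.1 hY).2 x
  have hZ := (isVertexCoverOn_iff.1 hZ).2 x
  simp only [mem_bothLayers, Finset.mem_sdiff, Finset.mem_compl] at hY hZ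
  simp only [Finset.mem_union]
  by_cases hx : x.1 ∈ T <;> by_cases hy : y.1 ∈ T
  · rcases hY hx y hy hxy with h | h <;> simp [h]
  · by_cases h : x ∈ Y
    · simp [h]
    · simp [mem_forced.2 ⟨hy, x, hx, h, hxy.symm⟩]
  · by_cases h : y ∈ Y
    · simp [h]
    · simp [mem_forced.2 ⟨hx, y, hy, h, hxy⟩]
  · by_cases h : x ∈ forced H T Y
    · simp [h]
    by_cases h' : y ∈ forced H T Y
    · simp [h']
    rcases hZ ⟨hx, h⟩ y ⟨hy, h'⟩ hxy with h | h <;> simp [h]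

/-- The edge between the two copies of a vertex forces at least one of them into `X`. -/
theorem card_eq_card_add_card_doubled {X : Finset (W × Bool)}
    (hX : ∀ x y, (doubleGraph H).Adj x y → x ∈ X ∨ y ∈ X) :
    X.card = Fintype.card W + (doubled X).card := by
  have h₁ : X.card = ∑ v : W, ((if (v, true) ∈ X then 1 else 0) + if (v, false) ∈ X then 1 else 0) := by
    rw [← Finset.filter_univ_mem X, Finset.card_filter, Fintype.sum_prod_type]
    simp only [Fintype.sum_bool, Finset.filter_univ_mem]
  rw [h₁, doubled, Finset.card_filter, ← Finset.card_univ, Finset.card_eq_sum_ones,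
    ← Finset.sum_add_distrib]
  refine Finset.sum_congr rfl fun v _ => ?_
  have := hX (v, false) (v, true) (.inr ⟨rfl, by simp⟩)
  split_ifs <;> tauto

theorem card_union_forced {Z : Finset (W × Bool)} (hY : Y ⊆ bothLayers T)
    (hZ : Z ⊆ bothLayers Tᶜ \ forced H T Y) :
    (Y ∪ forced H T Y ∪ Z).card = Y.card + (forced H T Y).card + Z.card := by
  rw [Finset.card_union_of_disjoint, Finset.card_union_of_disjoint]
  · exact Finset.disjoint_left.2 fun x hx hx' => (mem_forced.1 hx').1 (mem_bothLayers.1 (hY hx))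
  · refine Finset.disjoint_left.2 fun x hx hx' => ?_
    have hxZ := hZ hx'
    simp only [Finset.mem_sdiff, mem_bothLayers, Finset.mem_compl] at hxZ
    exact (Finset.mem_union.1 hx).elim (fun h => hxZ.1 (mem_bothLayers.1 (hY h))) hxZ.2

/-- Off `T'` exactly one copy of each vertex is covered. An edge whose ends have the same copy
covered would be uncovered in the other layer. -/
theorem Candidate.isOCT {T' : Finset W} (hY : IsVertexCoverOn (doubleGraph H) (bothLayers T) Y)
    (h : Candidate H T Y T') : IsOCT H T' := by
  obtain ⟨Z, hZ, rfl⟩ := h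
  set X := Y ∪ forced H T Y ∪ Z with hX
  have hcov : ∀ x y, (doubleGraph H).Adj x y → x ∈ X ∨ y ∈ X :=
    fun x y => mem_or_mem_of_adj hY hZ.1
  refine isOCT_iff.2 ⟨fun v => decide ((v, false) ∈ X), fun u v hu hv huv h => ?_⟩
  have h₁ := hcov (u, false) (v, false) (.inl ⟨huv, rfl⟩)
  have h₂ := hcov (u, true) (v, true) (.inl ⟨huv, rfl⟩)
  simp only [mem_doubled, Bool.forall_bool] at hu hv
  simp only [decide_eq_decide] at h
  tauto

theorem exists_candidate (H : SimpleGraph W) (T : Finset W) (Y : Finset (W × Bool)) :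
    ∃ T', Candidate H T Y T' :=
  let ⟨Z, hZ⟩ := exists_isMinVertexCoverOn (doubleGraph H) (bothLayers Tᶜ \ forced H T Y)
  ⟨_, Z, hZ, rfl⟩

/-- The copies `(v, c v)` with `v ∉ X'` are independent in `H²`, so their complement is a cover.
None of them is forced: a neighbour in `T` whose uncovered copy lies in layer `c v` would have the
colour `c v`. -/
theorem exists_cover_of_coloring {X' : Finset W} {c : W → Bool} (hT : Disjoint T X')
    (hc : ∀ u v, u ∉ X' → v ∉ X' → H.Adj u v → c u ≠ c v) :
    ∃ Z, IsVertexCoverOn (doubleGraph H) (bothLayers Tᶜ \ forced H T (choiceOf T c)) Z ∧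
      doubled (choiceOf T c ∪ forced H T (choiceOf T c) ∪ Z) = X' := by
  refine ⟨(bothLayers Tᶜ \ forced H T (choiceOf T c)).filter fun x => x.1 ∈ X' ∨ x.2 ≠ c x.1,
    isVertexCoverOn_iff.2 ⟨Finset.filter_subset _ _, fun x hx y hy hxy => ?_⟩, ?_⟩
  · simp only [Finset.mem_filter, hx, hy, true_and]
    by_contra! h
    rcases hxy with ⟨h₁, h₂⟩ | ⟨h₁, h₂⟩
    · exact hc _ _ h.1.1 h.2.1 h₁ (by rw [← h.1.2, ← h.2.2, h₂])
    · exact h₂ (by rw [h.1.2, h.2.2, h₁])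
  · ext v
    rw [mem_doubled]
    constructor
    · intro h
      by_contra hv
      have := h (c v)
      simp only [Finset.mem_union, mem_choiceOf, mem_forced, Finset.mem_filter, ne_eq,
        not_true_eq_false, and_false, hv, or_self, or_false, false_or] at this
      obtain ⟨hvT, y, hyT, hy, hadj⟩ := this
      simp only [hyT, true_and, not_not] at hy
      rcases hadj with ⟨h₁, h₂⟩ | ⟨h₁, h₂⟩
      · exact hc v y.1 hv (Finset.disjoint_left.1 hT hyT) h₁ (by rw [← hy, ← h₂])
      · exact hvT ((show v = y.1 from h₁) ▸ hyT)
    · intro hv b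
      have hvT : v ∉ T := fun h => Finset.disjoint_left.1 hT h hv
      by_cases h : (v, b) ∈ forced H T (choiceOf T c)
      · simp [h]
      · simp [h, hv, hvT, mem_bothLayers]

/-- The covers giving `T'` and `X'` share `Y` and the forced part, so comparing the doubled sets
amounts to comparing `Z` with `Z₀`. If `T'` is not smaller, `Z₀` is itself a minimum cover. -/
theorem card_candidate_le {X' : Finset W} {c : W → Bool} (hT : Disjoint T X')
    (hc : ∀ u v, u ∉ X' → v ∉ X' → H.Adj u v → c u ≠ c v) {T' : Finset W}
    (hT' : Candidate H T (choiceOf T c) T') :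
    T'.card ≤ X'.card ∧ (X'.card ≤ T'.card → Candidate H T (choiceOf T c) X') := by
  obtain ⟨Z₀, hZ₀, hX'⟩ := exists_cover_of_coloring hT hc
  obtain ⟨Z, hZ, rfl⟩ := hT'
  have hY : IsVertexCoverOn (doubleGraph H) (bothLayers T) (choiceOf T c) :=
    isVertexCoverOn_choiceOf fun u hu v hv =>
      hc u v (Finset.disjoint_left.1 hT hu) (Finset.disjoint_left.1 hT hv)
  have h₁ := card_eq_card_add_card_doubled fun x y => mem_or_mem_of_adj hY hZ.1 (x := x) (y := y)
  have h₂ := card_eq_card_add_card_doubled fun x y => mem_or_mem_of_adj hY hZ₀ (x := x) (y := y)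
  rw [card_union_forced hY.1 hZ.1.1] at h₁
  rw [card_union_forced hY.1 hZ₀.1, hX'] at h₂
  have h₃ := hZ.2 Z₀ hZ₀
  refine ⟨by omega, fun hle => ⟨Z₀, ⟨hZ₀, fun C hC => ?_⟩, hX'.symm⟩⟩
  have := hZ.2 C hC
  omega

theorem DisjointCompressionLoop.exists (H : SimpleGraph W) (T : Finset W)
    (Ys : List (Finset (W × Bool))) : ∃ out c, DisjointCompressionLoop H T Ys out c := by
  induction Ys with
  | nil => exact ⟨_, _, .done⟩
  | cons Y Ys ih =>
    obtain ⟨out, c, h⟩ := ih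
    by_cases hY : IsVertexCoverOn (doubleGraph H) (bothLayers T) Y
    · obtain ⟨T', hT'⟩ := exists_candidate H T Y
      by_cases hlt : T'.card < T.card
      · exact ⟨_, _, .found Y Ys T' hY hT' hlt⟩
      · exact ⟨_, _, .tooLarge Y Ys T' out c hY hT' hlt h⟩
    · exact ⟨_, _, .skip Y Ys out c hY h⟩

theorem DisjointCompressionLoop.spec {Ys : List (Finset (W × Bool))} {out : Option (Finset W)}
    {c : ℕ} (h : DisjointCompressionLoop H T Ys out c) :
    c ≤ Ys.length ∧ (out = none → c = Ys.length ∧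
      ∀ Y ∈ Ys, IsVertexCoverOn (doubleGraph H) (bothLayers T) Y →
        ∃ T', Candidate H T Y T' ∧ T.card ≤ T'.card) ∧
      ∀ T', out = some T' → IsOCT H T' ∧ T'.card < T.card := by
  induction h with
  | done => simp
  | skip Y Ys out c hY _ ih =>
    obtain ⟨h₁, h₂, h₃⟩ := ih
    refine ⟨by simpa using h₁, fun h => ⟨by simpa using (h₂ h).1, fun Y' hY' hcov => ?_⟩, h₃⟩
    rcases List.mem_cons.1 hY' with rfl | hY'
    · exact absurd hcov hY
    · exact (h₂ h).2 Y' hY' hcov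
  | found Y Ys T' hY hT' hlt =>
    refine ⟨by simp, by simp, fun T'' h => ?_⟩
    cases h
    exact ⟨hT'.isOCT hY, hlt⟩
  | tooLarge Y Ys T' out c hY hT' hlt _ ih =>
    obtain ⟨h₁, h₂, h₃⟩ := ih
    refine ⟨by simpa using h₁, fun h => ⟨by simpa using (h₂ h).1, fun Y' hY' hcov => ?_⟩, h₃⟩
    rcases List.mem_cons.1 hY' with rfl | hY'
    · exact ⟨T', hT', not_lt.1 hlt⟩
    · exact (h₂ h).2 Y' hY' hcov

theorem DisjointCompression.exists (H : SimpleGraph W) (T : Finset W) :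
    ∃ out c, DisjointCompression H T out c := by
  classical
  let Ys := (Finset.univ.filter fun Y => IsChoice T Y).toList
  obtain ⟨out, c, h⟩ := DisjointCompressionLoop.exists H T Ys
  exact ⟨out, c, Ys, Finset.nodup_toList _, by simp [Ys], h⟩

theorem DisjointCompression.card_le_of_none {X' : Finset W} {n : ℕ}
    (h : DisjointCompression H T none n) (hT : Disjoint T X') (hX' : IsOCT H X') :
    T.card ≤ X'.card := by
  obtain ⟨Ys, -, hm, hl⟩ := h
  obtain ⟨c, hc⟩ := isOCT_iff.1 hX'
  obtain ⟨T', hT', hle⟩ := (hl.spec.2.1 rfl).2 (choiceOf T c) ((hm _).2 (isChoice_choiceOf c))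
    (isVertexCoverOn_choiceOf fun u hu v hv =>
      hc u v (Finset.disjoint_left.1 hT hu) (Finset.disjoint_left.1 hT hv))
  exact hle.trans (card_candidate_le hT hc hT').1

/-- The run is arranged to try the choice of a colouring of `H - X'` first and to pick the cover
that doubles `X'`. -/
theorem DisjointCompression.of_minimum {X' : Finset W} (hT : Disjoint T X') (hX' : IsOCT H X')
    (hlt : X'.card < T.card) (hmin : ∀ X, IsOCT H X → X'.card ≤ X.card) :
    DisjointCompression H T (some X') 1 := by
  classical
  obtain ⟨c, hc⟩ := isOCT_iff.1 hX'
  have hY : IsVertexCoverOn (doubleGraph H) (bothLayers T) (choiceOf T c) :=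
    isVertexCoverOn_choiceOf fun u hu v hv =>
      hc u v (Finset.disjoint_left.1 hT hu) (Finset.disjoint_left.1 hT hv)
  obtain ⟨T', hT'⟩ := exists_candidate H T (choiceOf T c)
  have hcand := (card_candidate_le hT hc hT').2 (hmin T' (hT'.isOCT hY))
  refine ⟨choiceOf T c ::
    ((Finset.univ.filter fun Y => IsChoice T Y).erase (choiceOf T c)).toList, ?_, fun Y => ?_,
    .found _ _ _ hY hcand hlt⟩
  · simp [Finset.nodup_toList]
  · simp only [List.mem_cons, Finset.mem_toList, Finset.mem_erase, Finset.mem_filter,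
      Finset.mem_univ, true_and]
    by_cases h : Y = choiceOf T c
    · simp [h, isChoice_choiceOf]
    · simp [h]

end DisjointCompression

/-! ### The compression step -/

/-- The binomial expansion of `(2 + 1) ^ |S|` over the subsets of `S`; the added `1` is the term of
the empty set. -/
theorem sum_two_pow_card {V : Type*} [DecidableEq V] {S : Finset V} {Ts : List (Finset V)}
    (hn : Ts.Nodup) (hm : ∀ T, T ∈ Ts ↔ T ⊆ S ∧ T.Nonempty) :
    (Ts.map fun T => 2 ^ T.card).sum + 1 = 3 ^ S.card := by
  have h₁ : Ts.toFinset = S.powerset.erase ∅ := by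
    ext T
    simp [hm, Finset.nonempty_iff_ne_empty, and_comm]
  rw [← List.sum_toFinset _ hn, h₁]
  have h₂ := Finset.sum_pow_mul_eq_add_pow 2 1 S
  simp only [one_pow, mul_one] at h₂
  rw [← h₂, ← Finset.sum_erase_add _ _ (Finset.empty_mem_powerset S)]
  simp

theorem compressionCost_add_one (k : ℕ) : compressionCost k + 1 = 3 ^ (k + 1) := by
  have h := add_pow 2 1 (k + 1)
  rw [Finset.sum_range_eq_add_Ico _ (by omega)] at h
  rw [show 3 = 2 + 1 from rfl, h, compressionCost, add_comm]
  congr 1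
  · simp
  · refine Finset.sum_congr rfl fun i _ => ?_
    simp [mul_comm]

/-- `S \ (S \ X)` is `S ∩ X`, in the form `S \ T` taken by the deleted set when `T = S \ X`. -/
theorem card_sdiff_add_card_sdiff {V : Type*} [DecidableEq V] (S X : Finset V) :
    (X \ S).card + (S \ (S \ X)).card = X.card ∧ (S \ X).card + (S \ (S \ X)).card = S.card := by
  rw [sdiff_sdiff_right_self, Finset.inf_eq_inter]
  exact ⟨by rw [Finset.inter_comm]; exact Finset.card_sdiff_add_card_inter X S,
    Finset.card_sdiff_add_card_inter S X⟩

section Compression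

variable {V : Type*} [Fintype V] [DecidableEq V] {G : SimpleGraph V} {S T : Finset V}

theorem subset_compl_sdiff (S T : Finset V) : T ⊆ (S \ T)ᶜ :=
  fun v hv => by simp [hv]

theorem IsOCT.liftFrom_union {X : Finset {v // v ∈ (S \ T)ᶜ}}
    (h : IsOCT (inducedOn G (S \ T)ᶜ) X) : IsOCT G (liftFrom X ∪ (S \ T)) := by
  rw [isOCT_iff_colorableOn]
  refine (isOCT_inducedOn_iff.1 h).mono fun v hv => ?_
  simp only [Finset.mem_compl, Finset.mem_union, not_or] at hv
  exact Finset.mem_sdiff.2 ⟨Finset.mem_compl.2 hv.2, hv.1⟩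

theorem card_liftFrom_union {X : Finset {v // v ∈ (S \ T)ᶜ}} :
    (liftFrom X ∪ (S \ T)).card = X.card + (S \ T).card := by
  rw [Finset.card_union_of_disjoint, card_liftFrom]
  exact Finset.disjoint_left.2 fun v hv hv' => Finset.mem_compl.1 (liftFrom_subset X hv) hv'

theorem DisjointCompressionIn.isOCT {T' : Finset V} {c : ℕ} (hT : T ⊆ S)
    (h : DisjointCompressionIn G S T (some T') c) :
    IsOCT G (T' ∪ (S \ T)) ∧ (T' ∪ (S \ T)).card < S.card := by
  obtain ⟨_ | X, ⟨Ys, -, -, hl⟩, hX⟩ := h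
  · cases hX
  · cases hX
    obtain ⟨h₁, h₂⟩ := hl.spec.2.2 X rfl
    refine ⟨h₁.liftFrom_union, ?_⟩
    rw [card_restrictTo (subset_compl_sdiff S T)] at h₂
    rw [card_liftFrom_union, Finset.card_sdiff_of_subset hT]
    have := Finset.card_le_card hT
    omega

theorem DisjointCompressionIn.exists (G : SimpleGraph V) (S T : Finset V) :
    ∃ out c, DisjointCompressionIn G S T out c :=
  let ⟨out, c, h⟩ := DisjointCompression.exists (inducedOn G (S \ T)ᶜ) (restrictTo (S \ T)ᶜ T)
  ⟨out.map liftFrom, c, out, h, rfl⟩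

theorem DisjointCompressionIn.count {out : Option (Finset V)} {c : ℕ}
    (h : DisjointCompressionIn G S T out c) :
    c ≤ 2 ^ T.card ∧ (out = none → c = 2 ^ T.card) := by
  obtain ⟨out, ⟨Ys, hn, hm, hl⟩, rfl⟩ := h
  have hlen := length_choices hn hm
  rw [card_restrictTo (subset_compl_sdiff S T)] at hlen
  rw [← hlen]
  exact ⟨hl.spec.1, fun h => (hl.spec.2.1 (by simpa using h)).1⟩

/-- The vertices of a transversal outside `S`, as vertices of `G - (S ∩ X)`. -/
theorem isOCT_restrictTo_sdiff {X : Finset V} (hX : IsOCT G X) :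
    IsOCT (inducedOn G (S \ (S \ X))ᶜ) (restrictTo (S \ (S \ X))ᶜ (X \ S)) := by
  rw [isOCT_inducedOn_iff, liftFrom_restrictTo]
  · refine (isOCT_iff_colorableOn.1 hX).mono fun v hv => ?_
    simp only [Finset.mem_sdiff, Finset.mem_compl] at hv ⊢
    tauto
  · intro v hv
    simp only [Finset.mem_sdiff, Finset.mem_compl] at hv ⊢
    tauto

theorem sdiff_subset_compl (S X : Finset V) : X \ S ⊆ (S \ (S \ X))ᶜ := by
  intro v hv
  simp only [Finset.mem_sdiff, Finset.mem_compl] at hv ⊢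
  tauto

theorem disjoint_restrictTo_sdiff (S X : Finset V) :
    Disjoint (restrictTo (S \ (S \ X))ᶜ (S \ X)) (restrictTo (S \ (S \ X))ᶜ (X \ S)) := by
  refine Finset.disjoint_left.2 fun v hv hv' => ?_
  rw [mem_restrictTo, Finset.mem_sdiff] at hv hv'
  exact hv.2 hv'.1

/-- In `G - (S ∩ X)`, the set `X \ S` is a transversal disjoint from `S \ X`. Failure gives `|S \ X|
≤ |X \ S|`, and adding `|S ∩ X|` to both sides finishes. -/
theorem DisjointCompressionIn.card_le_of_none {X : Finset V} {c : ℕ} (hX : IsOCT G X)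
    (h : DisjointCompressionIn G S (S \ X) none c) : S.card ≤ X.card := by
  obtain ⟨_ | Y, h, hY⟩ := h
  · have := h.card_le_of_none (disjoint_restrictTo_sdiff S X) (isOCT_restrictTo_sdiff hX)
    rw [card_restrictTo (subset_compl_sdiff _ _), card_restrictTo (sdiff_subset_compl S X)] at this
    have := card_sdiff_add_card_sdiff S X
    omega
  · cases hY

theorem DisjointCompressionIn.of_minimum {X : Finset V} (hX : IsOCT G X) (hlt : X.card < S.card)
    (hmin : ∀ X', IsOCT G X' → X.card ≤ X'.card) :
    DisjointCompressionIn G S (S \ X) (some (X \ S)) 1 := by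
  have hc := card_sdiff_add_card_sdiff S X
  refine ⟨some (restrictTo _ (X \ S)), .of_minimum (disjoint_restrictTo_sdiff S X)
    (isOCT_restrictTo_sdiff hX) ?_ fun X' hX' => ?_, ?_⟩
  · rw [card_restrictTo (subset_compl_sdiff _ _), card_restrictTo (sdiff_subset_compl S X)]
    omega
  · rw [card_restrictTo (sdiff_subset_compl S X)]
    have := hmin _ hX'.liftFrom_union
    rw [card_liftFrom_union] at this
    omega
  · rw [Option.map_some, liftFrom_restrictTo (sdiff_subset_compl S X)]

theorem CompressionLoop.exists (G : SimpleGraph V) (S : Finset V) (Ts : List (Finset V)) :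
    ∃ out c, CompressionLoop G S Ts out c := by
  induction Ts with
  | nil => exact ⟨_, _, .done⟩
  | cons T Ts ih =>
    obtain ⟨out, d, h⟩ := ih
    obtain ⟨_ | T', c, hT⟩ := DisjointCompressionIn.exists G S T
    · exact ⟨_, _, .next T Ts out c d hT h⟩
    · exact ⟨_, _, .found T Ts T' c hT⟩

theorem CompressionLoop.spec {Ts : List (Finset V)} {out : Option (Finset V)} {c : ℕ}
    (h : CompressionLoop G S Ts out c) (hTs : ∀ T ∈ Ts, T ⊆ S) :
    c ≤ (Ts.map fun T => 2 ^ T.card).sum ∧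
      (out = none → c = (Ts.map fun T => 2 ^ T.card).sum ∧
        ∀ T ∈ Ts, ∃ d, DisjointCompressionIn G S T none d) ∧
      ∀ X, out = some X → IsOCT G X ∧ X.card < S.card := by
  induction h with
  | done => simp
  | found T Ts T' c hT =>
    refine ⟨by simpa using hT.count.1.trans (Nat.le_add_right _ _), by simp, fun X hX => ?_⟩
    cases hX
    exact hT.isOCT (hTs T (by simp))
  | next T Ts out c d hT _ ih =>
    obtain ⟨h₁, h₂, h₃⟩ := ih fun T hT => hTs T (by simp [hT])
    have hc := hT.count.2 rfl
    simp only [List.map_cons, List.sum_cons, List.mem_cons]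
    refine ⟨by omega, fun h => ⟨by rw [(h₂ h).1, hc], ?_⟩, h₃⟩
    rintro T' (rfl | hT')
    · exact ⟨c, hT⟩
    · exact (h₂ h).2 T' hT'

theorem Compression.exists (G : SimpleGraph V) (S : Finset V) : ∃ out c, Compression G S out c := by
  obtain ⟨out, c, h⟩ := CompressionLoop.exists G S (S.powerset.erase ∅).toList
  exact ⟨out, c, _, Finset.nodup_toList _, by
    simp [Finset.nonempty_iff_ne_empty, and_comm], h⟩

theorem Compression.isOCT {X : Finset V} {c : ℕ} (h : Compression G S (some X) c) :
    IsOCT G X ∧ X.card < S.card := by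
  obtain ⟨Ts, -, hm, h⟩ := h
  exact (h.spec fun T hT => ((hm T).1 hT).1).2.2 X rfl

theorem Compression.card_le_of_none {X : Finset V} {c : ℕ} (h : Compression G S none c)
    (hX : IsOCT G X) : S.card ≤ X.card := by
  obtain ⟨Ts, -, hm, h⟩ := h
  by_contra hlt
  -- A transversal smaller than `S` misses part of it, so `T = S \ X` is among the sets tried.
  have hne : (S \ X).Nonempty := by
    rw [← Finset.card_pos]
    have := card_sdiff_add_card_sdiff S X
    omega
  obtain ⟨d, hd⟩ := ((h.spec fun T hT => ((hm T).1 hT).1).2.1 rfl).2 (S \ X)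
    ((hm _).2 ⟨Finset.sdiff_subset, hne⟩)
  exact hlt (hd.card_le_of_none hX)

theorem Compression.count {out : Option (Finset V)} {c k : ℕ} (h : Compression G S out c)
    (hS : S.card = k + 1) :
    c ≤ compressionCost k ∧ (out = none → c = compressionCost k) := by
  obtain ⟨Ts, hn, hm, h⟩ := h
  have h₁ := sum_two_pow_card hn hm
  rw [hS, ← compressionCost_add_one, Nat.add_right_cancel_iff] at h₁
  have h₂ := h.spec fun T hT => ((hm T).1 hT).1
  rw [h₁] at h₂
  exact ⟨h₂.1, fun h => (h₂.2.1 h).1⟩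

/-- Every minimum odd cycle transversal is a possible output, if it is smaller than `S`. -/
theorem Compression.of_minimum {X : Finset V} (hX : IsOCT G X) (hlt : X.card < S.card)
    (hmin : ∀ X', IsOCT G X' → X.card ≤ X'.card) : Compression G S (some X) 1 := by
  have hc := card_sdiff_add_card_sdiff S X
  have hne : (S \ X).Nonempty := by rw [← Finset.card_pos]; omega
  have hun : X \ S ∪ (S \ (S \ X)) = X := by
    ext v
    simp only [Finset.mem_union, Finset.mem_sdiff]
    tauto
  refine ⟨(S \ X) :: ((S.powerset.erase ∅).erase (S \ X)).toList, ?_, fun T => ?_, ?_⟩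
  · simp [Finset.nodup_toList]
  · simp only [List.mem_cons, Finset.mem_toList, Finset.mem_erase, Finset.mem_powerset,
      Finset.nonempty_iff_ne_empty]
    by_cases h : T = S \ X
    · simpa [h] using hne.ne_empty
    · simp [h, and_comm]
  · have := CompressionLoop.found (S \ X) ((S.powerset.erase ∅).erase (S \ X)).toList (X \ S) 1
      (DisjointCompressionIn.of_minimum hX hlt hmin)
    rwa [hun] at this

/-- Some run exists, and it cannot return a set, since that set would be a smaller transversal. -/
theorem Compression.none_of_forall_le (h : ∀ X, IsOCT G X → S.card ≤ X.card) :
    ∃ c, Compression G S none c := by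
  obtain ⟨_ | X, c, hc⟩ := Compression.exists G S
  · exact ⟨c, hc⟩
  · exact absurd (h X hc.isOCT.1) (not_le.2 hc.isOCT.2)

end Compression

/-! ### Iterative compression -/

section Iterative

variable {V : Type*} [DecidableEq V] {G : SimpleGraph V}

theorem IsOCT.restrictTo [Fintype V] {X : Finset V} (hX : IsOCT G X) (A : Finset V) :
    IsOCT (inducedOn G A) (restrictTo A X) := by
  rw [isOCT_inducedOn_iff]
  refine (isOCT_iff_colorableOn.1 hX).mono fun v hv => ?_
  rw [Finset.mem_sdiff, mem_liftFrom] at hv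
  exact Finset.mem_compl.2 fun h => hv.2 ⟨hv.1, mem_restrictTo.2 h⟩

theorem card_restrictTo_le (A X : Finset V) : (restrictTo A X).card ≤ X.card := by
  rw [← card_liftFrom]
  refine Finset.card_le_card fun v hv => ?_
  obtain ⟨h, hv⟩ := mem_liftFrom.1 hv
  exact mem_restrictTo.1 hv

theorem ColorableOn.insert {A X : Finset V} {v : V} (h : ColorableOn G (A \ X)) :
    ColorableOn G (insert v A \ insert v X) :=
  h.mono fun u hu => by
    simp only [Finset.mem_sdiff, Finset.mem_insert, not_or] at hu ⊢
    exact ⟨hu.1.resolve_left hu.2.1, hu.2.2⟩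

theorem IterativeCompressionLoop.exists (G : SimpleGraph V) (k : ℕ) (vs : List V)
    (A X : Finset V) : ∃ out c, IterativeCompressionLoop G k vs A X out c := by
  induction vs generalizing A X with
  | nil => exact ⟨_, _, .done A X⟩
  | cons v vs ih =>
    by_cases hk : (insert v X).card ≤ k
    · obtain ⟨out, c, h⟩ := ih (insert v A) (insert v X)
      exact ⟨out, c, .grow v vs A X out c hk h⟩
    · obtain ⟨_ | X', c, hc⟩ :=
        Compression.exists (inducedOn G (insert v A)) (restrictTo (insert v A) (insert v X))
      · exact ⟨none, c, .giveUp v vs A X c (not_le.1 hk) hc⟩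
      · obtain ⟨out, d, h⟩ := ih (insert v A) (liftFrom X')
        exact ⟨out, c + d, .compress v vs A X X' out c d (not_le.1 hk) hc h⟩

/-- A compression requires `|X| = k`, hence `|A| ≥ k`. The minimum counts the additions that can
still lead to one: its second term is relevant while `|A| < k`, its first afterwards. -/
theorem IterativeCompressionLoop.spec [Fintype V] {k : ℕ} {vs : List V} {A X : Finset V}
    {out : Option (Finset V)} {c : ℕ} (h : IterativeCompressionLoop G k vs A X out c)
    (hvs : vs.Nodup) (hA : ∀ v ∈ vs, v ∉ A) (hall : ∀ v, v ∈ vs ∨ v ∈ A) (hXA : X ⊆ A)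
    (hX : ColorableOn G (A \ X)) (hk : X.card ≤ k) :
    (∀ Z, out = some Z → IsOCT G Z ∧ Z.card ≤ k) ∧
      (out = none → ∀ Z, IsOCT G Z → k < Z.card) ∧
      c ≤ min vs.length (A.card + vs.length - k) * compressionCost k := by
  induction h with
  | done A X =>
    refine ⟨fun Z hZ => ?_, by simp, by simp⟩
    cases hZ
    refine ⟨isOCT_iff_colorableOn.2 (hX.mono fun v hv => ?_), hk⟩
    exact Finset.mem_sdiff.2 ⟨by simpa using hall v, Finset.mem_compl.1 hv⟩
  | grow v vs A X out c hle _ ih =>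
    have hvA := hA v (by simp)
    obtain ⟨h₁, h₂, h₃⟩ := ih (List.nodup_cons.1 hvs).2 (fun u hu => by
        rw [Finset.mem_insert, not_or]
        exact ⟨fun h => (List.nodup_cons.1 hvs).1 (h ▸ hu), hA u (by simp [hu])⟩)
      (fun u => by have := hall u; simp only [List.mem_cons, Finset.mem_insert] at this ⊢; tauto)
      (Finset.insert_subset_insert v hXA) hX.insert hle
    refine ⟨h₁, h₂, h₃.trans (Nat.mul_le_mul_right _ ?_)⟩
    rw [Finset.card_insert_of_notMem hvA, List.length_cons]
    omega
  | compress v vs A X X' out c d hlt hc _ ih =>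
    have hvA := hA v (by simp)
    have hvX : v ∉ X := fun h => hvA (hXA h)
    have hsub : insert v X ⊆ insert v A := Finset.insert_subset_insert v hXA
    have hcard : (restrictTo (insert v A) (insert v X)).card = k + 1 := by
      rw [card_restrictTo hsub, Finset.card_insert_of_notMem hvX]
      rw [Finset.card_insert_of_notMem hvX] at hlt
      omega
    have hkA := Finset.card_le_card hXA
    rw [Finset.card_insert_of_notMem hvX] at hlt
    obtain ⟨hX', hX'k⟩ := hc.isOCT
    obtain ⟨h₁, h₂, h₃⟩ := ih (List.nodup_cons.1 hvs).2 (fun u hu => by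
        rw [Finset.mem_insert, not_or]
        exact ⟨fun h => (List.nodup_cons.1 hvs).1 (h ▸ hu), hA u (by simp [hu])⟩)
      (fun u => by have := hall u; simp only [List.mem_cons, Finset.mem_insert] at this ⊢; tauto)
      (liftFrom_subset X') (isOCT_inducedOn_iff.1 hX') (by rw [card_liftFrom]; omega)
    refine ⟨h₁, h₂, (Nat.add_le_add (hc.count hcard).1 h₃).trans ?_⟩
    rw [Nat.add_comm, ← Nat.succ_mul]
    refine Nat.mul_le_mul_right _ ?_
    rw [Finset.card_insert_of_notMem hvA, List.length_cons]
    omega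
  | giveUp v vs A X c hlt hc =>
    have hvA := hA v (by simp)
    have hvX : v ∉ X := fun h => hvA (hXA h)
    have hsub : insert v X ⊆ insert v A := Finset.insert_subset_insert v hXA
    have hcard : (restrictTo (insert v A) (insert v X)).card = k + 1 := by
      rw [card_restrictTo hsub, Finset.card_insert_of_notMem hvX]
      rw [Finset.card_insert_of_notMem hvX] at hlt
      omega
    have hkA := Finset.card_le_card hXA
    rw [Finset.card_insert_of_notMem hvX] at hlt
    refine ⟨by simp, fun _ Z hZ => ?_, (hc.count hcard).1.trans (Nat.le_mul_of_pos_left _ ?_)⟩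
    -- A transversal of `G` restricts to the current subgraph, where every transversal has at least
    -- `k + 1` vertices.
    · have := hc.card_le_of_none (IsOCT.restrictTo hZ (insert v A))
      have := card_restrictTo_le (insert v A) Z
      omega
    · rw [List.length_cons]
      omega

theorem IterativeCompression.spec [Fintype V] {k : ℕ} {out : Option (Finset V)} {c : ℕ}
    (h : IterativeCompression G k out c) :
    (∀ X, out = some X → IsOCT G X ∧ X.card ≤ k) ∧
      (out.isSome ↔ ∃ X : Finset V, IsOCT G X ∧ X.card ≤ k) ∧
      c ≤ (Fintype.card V - k) * compressionCost k := by
  obtain ⟨vs, hn, hm, h⟩ := h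
  obtain ⟨h₁, h₂, h₃⟩ := h.spec hn (by simp) (fun v => .inl (hm v)) (Finset.Subset.refl _)
    ⟨fun _ => false, by simp⟩ (by simp)
  refine ⟨h₁, ?_, h₃.trans (Nat.mul_le_mul_right _ ?_)⟩
  · cases out with
    | none =>
      simp only [Option.isSome_none, Bool.false_eq_true, false_iff, not_exists, not_and, not_le]
      exact h₂ rfl
    | some X => simpa using ⟨X, h₁ X rfl⟩
  · have : vs.length = Fintype.card V := by
      rw [← List.toFinset_card_of_nodup hn, ← Finset.card_univ]
      congr 1
      ext v
      simp [hm]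
    rw [Finset.card_empty, this]
    omega

theorem IterativeCompression.exists [Fintype V] (G : SimpleGraph V) (k : ℕ) :
    ∃ out c, IterativeCompression G k out c := by
  obtain ⟨out, c, h⟩ := IterativeCompressionLoop.exists G k (Finset.univ : Finset V).toList ∅ ∅
  exact ⟨out, c, _, Finset.nodup_toList _, by simp, h⟩

end Iterative

/-! ### The programs -/

section Vectors

variable {n : ℕ}

/-- The characteristic vector of a set. -/
def vecOf (S : Finset (Fin n)) : Fin n → Bool := fun i => decide (i ∈ S)

/-- The set with a given characteristic vector. -/
def trueSet (z : Fin n → Bool) : Finset (Fin n) := Finset.univ.filter fun i => z i = true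

open Classical in
/-- The adjacency matrix of a graph. -/
noncomputable def matrixOf (G : SimpleGraph (Fin n)) (i j : Fin n) : Bool := decide (G.Adj i j)

theorem mem_trueSet {z : Fin n → Bool} {i : Fin n} : i ∈ trueSet z ↔ z i = true := by
  simp [trueSet]

theorem vecOf_trueSet (z : Fin n → Bool) : vecOf (trueSet z) = z := by
  funext i
  simp [vecOf, mem_trueSet]

theorem trueSet_vecOf (S : Finset (Fin n)) : trueSet (vecOf S) = S := by
  ext i
  simp [vecOf, mem_trueSet]

theorem countTrue_eq_card_trueSet (z : Fin n → Bool) : countTrue z = (trueSet z).card :=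
  countTrue_eq_card z

theorem countTrue_vecOf (S : Finset (Fin n)) : countTrue (vecOf S) = S.card := by
  rw [countTrue_eq_card_trueSet, trueSet_vecOf]

theorem matrixOf_symm (G : SimpleGraph (Fin n)) (i j : Fin n) : matrixOf G i j = matrixOf G j i := by
  rw [matrixOf, matrixOf, decide_eq_decide]
  exact G.adj_comm i j

theorem encodeOutput_map (o : Option (Fin n → Bool)) :
    encodeOutput (o.map trueSet) = code (α := fun n => Option (Fin n → Bool)) o := by
  cases o with
  | none => rfl
  | some z =>
    show Val.cons .nil (encodeSet _) = Val.cons .nil _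
    congr 1
    show encodeList (List.ofFn fun i => encodeBool (vecOf (trueSet z) i)) = _
    rw [vecOf_trueSet]
    rfl

theorem exists_properOff_iff {G : SimpleGraph (Fin n)} {z : Fin n → Bool} :
    (∃ c, ProperOff (matrixOf G) z c) ↔ IsOCT G (trueSet z) := by
  simp only [isOCT_iff, ProperOff, mem_trueSet, Bool.not_eq_true, matrixOf, decide_eq_true_eq]

theorem exists_properOff_mask_iff {G : SimpleGraph (Fin n)} {A : Finset (Fin n)} {z : Fin n → Bool} :
    (∃ c, ProperOff (maskMatrix (matrixOf G) (vecOf A)) z c) ↔ ColorableOn G (A \ trueSet z) := by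
  refine exists_congr fun c => ?_
  simp only [ProperOff, maskMatrix, matrixOf, vecOf, Bool.and_eq_true, decide_eq_true_eq,
    Finset.mem_sdiff, mem_trueSet, Bool.not_eq_true]
  exact ⟨fun h u hu v hv huv => h u v hu.2 hv.2 ⟨huv, hu.1, hv.1⟩,
    fun h u v hu hv huv => h u ⟨huv.2.1, hu⟩ v ⟨huv.2.2, hv⟩ huv.1⟩

theorem maskMatrix_symm {g : Fin n → Fin n → Bool} (hg : ∀ u v, g u v = g v u) (a : Fin n → Bool)
    (u v : Fin n) : maskMatrix g a u v = maskMatrix g a v u := by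
  simp only [maskMatrix, hg u v, Bool.and_comm]

end Vectors

/-- A feasible function of a graph and further data is computed by a program that is not given the
order of the graph. -/
theorem Feasible.exists_prog {β γ : ℕ → Type} [Code β] [Code γ]
    {τ : ∀ n, (Fin n → Fin n → Bool) × β n → ℕ} {f : ∀ n, (Fin n → Fin n → Bool) × β n → γ n}
    (hf : Feasible τ f) : ∃ (P : Prog) (p : Polynomial ℕ), ∀ n (G : SimpleGraph (Fin n)) (b : β n),
      RunsWithin P (.cons (encodeGraph G) (code b)) (code (f n (matrixOf G, b)))
        ((τ n (matrixOf G, b) + 1) * p.eval n) := by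
  obtain ⟨L, hL⟩ := exists_prog_length
  obtain ⟨P, p, hP⟩ := hf
  refine ⟨.seq (.cons (.seq .head L) .skip) P, p + 50 * .X + 60, fun n G b => ?_⟩
  have h := hL (List.ofFn fun i => encodeList (List.ofFn fun j => encodeBool (matrixOf G i j)))
  rw [List.length_ofFn] at h
  refine ((((Run.head _).within.seq h).cons (Run.skip _).within).seq (hP n (matrixOf G, b))).mono ?_
  simp only [Polynomial.eval_add, Polynomial.eval_mul, Polynomial.eval_ofNat, Polynomial.eval_X]
  nlinarith [Nat.zero_le (τ n (matrixOf G, b) * (50 * n + 60))]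

/-- A returned set is a minimum transversal smaller than `S`, which the compression step can output
in some run; a failure means that `S` is already minimum. -/
theorem compression_compressStep {n : ℕ} {G : SimpleGraph (Fin n)} {S : Finset (Fin n)}
    (hS : IsOCT G S) :
    ∃ c, Compression G S ((compressStep (matrixOf G) (vecOf S)).map trueSet) c := by
  have hp : ∃ c, ProperOff (matrixOf G) (vecOf S) c :=
    exists_properOff_iff.2 (by rwa [trueSet_vecOf])
  have hX : ∀ X, IsOCT G X → ∃ c, ProperOff (matrixOf G) (vecOf X) c := fun X hX =>
    exists_properOff_iff.2 (by rwa [trueSet_vecOf])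
  cases h : compressStep (matrixOf G) (vecOf S) with
  | none =>
    refine Compression.none_of_forall_le fun X hXG => ?_
    obtain ⟨c, hc⟩ := hX X hXG
    simpa only [countTrue_vecOf] using compressStep_eq_none (matrixOf_symm G) hp h hc
  | some z =>
    obtain ⟨h₁, h₂, h₃⟩ := compressStep_eq_some (matrixOf_symm G) hp h
    rw [countTrue_vecOf, countTrue_eq_card_trueSet] at h₂
    refine ⟨1, .of_minimum (exists_properOff_iff.1 h₁) h₂ fun X hXG => ?_⟩
    obtain ⟨c, hc⟩ := hX X hXG
    have := h₃ _ c hc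
    rwa [countTrue_vecOf, countTrue_eq_card_trueSet] at this

/-- The compression step on an induced subgraph. -/
theorem compression_compressStep_mask {n : ℕ} {G : SimpleGraph (Fin n)} {A S : Finset (Fin n)}
    (hSA : S ⊆ A) (hS : ColorableOn G (A \ S)) :
    (compressStep (maskMatrix (matrixOf G) (vecOf A)) (vecOf S) = none →
      ∃ c, Compression (inducedOn G A) (restrictTo A S) none c) ∧
    ∀ z, compressStep (maskMatrix (matrixOf G) (vecOf A)) (vecOf S) = some z →
      trueSet z ⊆ A ∧ ∃ c, Compression (inducedOn G A) (restrictTo A S)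
        (some (restrictTo A (trueSet z))) c := by
  have hg := maskMatrix_symm (matrixOf_symm G) (vecOf A)
  have hp : ∃ c, ProperOff (maskMatrix (matrixOf G) (vecOf A)) (vecOf S) c :=
    exists_properOff_mask_iff.2 (by rwa [trueSet_vecOf])
  have hX : ∀ X, ColorableOn G (A \ X) →
      ∃ c, ProperOff (maskMatrix (matrixOf G) (vecOf A)) (vecOf X) c := fun X hX =>
    exists_properOff_mask_iff.2 (by rwa [trueSet_vecOf])
  constructor
  · refine fun h => Compression.none_of_forall_le fun X hXG => ?_
    obtain ⟨c, hc⟩ := hX _ (isOCT_inducedOn_iff.1 hXG)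
    have := compressStep_eq_none hg hp h hc
    rwa [countTrue_vecOf, countTrue_vecOf, card_liftFrom, ← card_restrictTo hSA] at this
  · intro z h
    obtain ⟨h₁, h₂, h₃⟩ := compressStep_eq_some hg hp h
    have hmin : ∀ X, ColorableOn G (A \ X) → (trueSet z).card ≤ X.card := fun X hXG => by
      obtain ⟨c, hc⟩ := hX X hXG
      have := h₃ _ c hc
      rwa [countTrue_vecOf, countTrue_eq_card_trueSet] at this
    have hz := exists_properOff_mask_iff.1 h₁
    -- The program deletes edges rather than vertices, so vertices outside `A` are isolated.
    -- Dropping them from `z` leaves a transversal, and minimality excludes them.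
    have hzA : trueSet z ⊆ A := by
      have := hmin (trueSet z ∩ A) (by rwa [Finset.sdiff_inter_self_right])
      exact Finset.inter_eq_left.1 (Finset.eq_of_subset_of_card_le Finset.inter_subset_left this)
    refine ⟨hzA, 1, .of_minimum ?_ ?_ fun X hXG => ?_⟩
    · rwa [isOCT_inducedOn_iff, liftFrom_restrictTo hzA]
    · rwa [card_restrictTo hzA, card_restrictTo hSA, ← countTrue_eq_card_trueSet, ← countTrue_vecOf S]
    · rw [card_restrictTo hzA, ← card_liftFrom X]
      exact hmin _ (isOCT_inducedOn_iff.1 hXG)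

theorem vecOf_insert {n : ℕ} (v : Fin n) (A : Finset (Fin n)) :
    (fun w => w == v || vecOf A w) = vecOf (insert v A) := by
  funext w
  simp [vecOf, Finset.mem_insert, beq_eq_decide]

theorem iterStep_vecOf {n : ℕ} (g : Fin n → Fin n → Bool) (k : ℕ) (v : Fin n)
    (A X : Finset (Fin n)) : iterStep g k v (true, vecOf A, vecOf X) =
      if (insert v X).card ≤ k then (true, vecOf (insert v A), vecOf (insert v X))
      else if (insert v X).card ≤ k + 1 then
        let o := compressStep (maskMatrix g (vecOf (insert v A))) (vecOf (insert v X))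
        (o.isSome, vecOf (insert v A), o.getD (vecOf (insert v X)))
      else (false, vecOf (insert v A), vecOf (insert v X)) := by
  simp only [iterStep, vecOf_insert, countTrue_vecOf, if_true, decide_eq_true_eq]

theorem foldl_iterStep_false {n : ℕ} {g : Fin n → Fin n → Bool} {k : ℕ} (vs : List (Fin n))
    (a y : Fin n → Bool) :
    vs.foldl (fun x v => iterStep g k v x) (false, a, y) = (false, a, y) := by
  induction vs with
  | nil => rfl
  | cons v vs ih => rwa [List.foldl_cons, show iterStep g k v (false, a, y) = (false, a, y) by simp [iterStep]]

theorem iterativeCompressionLoop_foldl {n : ℕ} {G : SimpleGraph (Fin n)} {k : ℕ}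
    (vs : List (Fin n)) (A X : Finset (Fin n)) (hvs : vs.Nodup) (hA : ∀ v ∈ vs, v ∉ A)
    (hXA : X ⊆ A) (hX : ColorableOn G (A \ X)) (hk : X.card ≤ k)
    {x : Bool × (Fin n → Bool) × (Fin n → Bool)}
    (hx : x = vs.foldl (fun x v => iterStep (matrixOf G) k v x) (true, vecOf A, vecOf X)) :
    ∃ c, IterativeCompressionLoop G k vs A X
      ((if x.1 = true then some x.2.2 else none).map trueSet) c := by
  induction vs generalizing A X with
  | nil =>
    subst hx
    refine ⟨0, ?_⟩
    simp only [List.foldl_nil, if_true, Option.map_some, trueSet_vecOf]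
    exact .done A X
  | cons v vs ih =>
    have hvA := hA v (by simp)
    have hvX : v ∉ X := fun h => hvA (hXA h)
    have hsub : insert v X ⊆ insert v A := Finset.insert_subset_insert v hXA
    have hvs' := (List.nodup_cons.1 hvs).2
    have hA' : ∀ u ∈ vs, u ∉ insert v A := fun u hu => by
      rw [Finset.mem_insert, not_or]
      exact ⟨fun h => (List.nodup_cons.1 hvs).1 (h ▸ hu), hA u (by simp [hu])⟩
    rw [List.foldl_cons, iterStep_vecOf] at hx
    split_ifs at hx with h₁ h₂
    · obtain ⟨c, hc⟩ := ih _ _ hvs' hA' hsub hX.insert h₁ hx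
      exact ⟨c, .grow v vs A X _ c h₁ hc⟩
    · obtain ⟨hn, hs⟩ := compression_compressStep_mask hsub hX.insert
      cases ho : compressStep (maskMatrix (matrixOf G) (vecOf (insert v A))) (vecOf (insert v X)) with
      | none =>
        obtain ⟨c, hc⟩ := hn ho
        rw [ho] at hx
        simp only [Option.isSome_none, foldl_iterStep_false] at hx
        subst hx
        exact ⟨c, .giveUp v vs A X c (not_le.1 h₁) hc⟩
      | some z =>
        obtain ⟨hzA, c, hc⟩ := hs z ho
        have hlift := liftFrom_restrictTo hzA
        have hoct := hc.isOCT
        rw [isOCT_inducedOn_iff, hlift, card_restrictTo hzA, card_restrictTo hsub] at hoct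
        rw [ho] at hx
        simp only [Option.isSome_some, Option.getD_some] at hx
        rw [← vecOf_trueSet z] at hx
        obtain ⟨d, hd⟩ := ih _ _ hvs' hA' hzA hoct.1 (by omega) hx
        exact ⟨c + d, .compress v vs A X _ _ c d (not_le.1 h₁) hc (by rwa [hlift])⟩
    -- The safeguard branch is unreachable: `X` had at most `k` vertices.
    · rw [Finset.card_insert_of_notMem hvX] at h₁ h₂
      omega

theorem iterativeCompression_iterCompress {n : ℕ} (G : SimpleGraph (Fin n)) (k : ℕ) :
    ∃ c, IterativeCompression G k ((iterCompress (matrixOf G) k).map trueSet) c := by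
  have hempty : vecOf (∅ : Finset (Fin n)) = fun _ => false := by
    funext i
    simp [vecOf]
  obtain ⟨c, hc⟩ := iterativeCompressionLoop_foldl (G := G) (k := k) (List.finRange n).reverse ∅ ∅
    (List.nodup_reverse.2 (List.nodup_finRange n)) (by simp) (Finset.Subset.refl _)
    ⟨fun _ => false, by simp⟩ (by simp) rfl
  -- The program's right fold adds the vertices in decreasing order, one of the admissible orders.
  rw [List.foldl_reverse, hempty] at hc
  exact ⟨c, _, List.nodup_reverse.2 (List.nodup_finRange n), by simp, hc⟩

/-! ### The theorem. -/

theorem mainTheorem2 :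
    -- the compression step is correct and makes at most `compressionCost k` iterations
    (∀ (V : Type*) [Fintype V] [DecidableEq V] (G : SimpleGraph V) (k : ℕ) (S : Finset V),
      IsOCT G S → S.card = k + 1 →
        (∀ T ⊆ S, ∀ (T' : Finset V) (c : ℕ), DisjointCompressionIn G S T (some T') c →
          IsOCT G (T' ∪ (S \ T)) ∧ (T' ∪ (S \ T)).card ≤ k) ∧
        (∃ out c, Compression G S out c) ∧
        (∀ out c, Compression G S out c →
          (∀ X, out = some X → IsOCT G X ∧ X.card ≤ k) ∧
          (out.isSome ↔ ∃ X : Finset V, IsOCT G X ∧ X.card ≤ k) ∧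
          c ≤ compressionCost k ∧ (out = none → c = compressionCost k))) ∧
    -- the sum is `3 ^ (k + 1) - 1`
    (∀ k : ℕ, compressionCost k + 1 = 3 ^ (k + 1)) ∧
    -- the compression step can be carried out in time `compressionCost k * n ^ O(1)`
    (∃ (P : Prog) (p : Polynomial ℕ), ∀ (n k : ℕ) (G : SimpleGraph (Fin n)) (S : Finset (Fin n)),
      IsOCT G S → S.card = k + 1 →
        ∃ out c t, Run P (.cons (encodeGraph G) (encodeSet S)) (encodeOutput out) t ∧
          Compression G S out c ∧ t ≤ compressionCost k * p.eval n) ∧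
    -- iterative compression is correct and makes at most `n - k` compressions
    (∀ (V : Type*) [Fintype V] [DecidableEq V] (G : SimpleGraph V) (k : ℕ),
      (∃ out c, IterativeCompression G k out c) ∧
      (∀ out c, IterativeCompression G k out c →
        (∀ X, out = some X → IsOCT G X ∧ X.card ≤ k) ∧
        (out.isSome ↔ ∃ X : Finset V, IsOCT G X ∧ X.card ≤ k) ∧
        c ≤ (Fintype.card V - k) * compressionCost k)) ∧
    -- it gives an algorithm for odd cycle transversal with running time `3 ^ k * n ^ O(1)`
    (∃ (P : Prog) (p : Polynomial ℕ), ∀ (n k : ℕ) (G : SimpleGraph (Fin n)),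
      ∃ out c t, Run P (.cons (encodeGraph G) (encodeNat k)) (encodeOutput out) t ∧
        IterativeCompression G k out c ∧
        (out.isSome ↔ ∃ X : Finset (Fin n), IsOCT G X ∧ X.card ≤ k) ∧
        t ≤ 3 ^ k * p.eval n) := by
  refine ⟨fun V _ _ G k S hS hk => ⟨fun T hT T' c h => ?_, Compression.exists G S,
    fun out c h => ⟨fun X hX => ?_, ?_, h.count hk⟩⟩, compressionCost_add_one, ?_,
    fun V _ _ G k => ⟨IterativeCompression.exists G k, fun out c h => h.spec⟩, ?_⟩
  · have := h.isOCT hT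
    exact ⟨this.1, by omega⟩
  · subst hX
    have := h.isOCT
    exact ⟨this.1, by omega⟩
  · cases out with
    | none =>
      simp only [Option.isSome_none, Bool.false_eq_true, false_iff, not_exists, not_and, not_le]
      intro X hX
      have := h.card_le_of_none hX
      omega
    | some X =>
      have := h.isOCT
      simpa using ⟨X, this.1, by omega⟩
  · obtain ⟨P, p, hP⟩ := Feasible.compress.exists_prog
    -- The bound `3 ^ (k + 1) + 1` equals `compressionCost k + 2`, which is at most `3 *
    -- compressionCost k`.
    refine ⟨P, 3 * p, fun n k G S hS hk => ?_⟩
    obtain ⟨t, ht, hr⟩ := hP n G (vecOf S)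
    obtain ⟨c, hc⟩ := compression_compressStep hS
    refine ⟨_, c, t, ?_, hc, ht.trans ?_⟩
    · rw [encodeOutput_map]
      exact hr
    · have h := compressionCost_add_one k
      have hpos : 3 ≤ 3 ^ (k + 1) := Nat.le_self_pow (by omega) 3
      rw [countTrue_vecOf, hk, ← h, Polynomial.eval_mul, Polynomial.eval_ofNat, ← mul_assoc]
      exact Nat.mul_le_mul_right _ (by omega)
  · obtain ⟨P, p, hP⟩ := Feasible.iterative.exists_prog
    -- The factor comes from `3 ^ (k + 1) + 1 ≤ 4 * 3 ^ k`.
    refine ⟨P, 4 * p, fun n k G => ?_⟩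
    obtain ⟨t, ht, hr⟩ := hP n G k
    obtain ⟨c, hc⟩ := iterativeCompression_iterCompress G k
    refine ⟨_, c, t, ?_, hc, hc.spec.2.1, ht.trans ?_⟩
    · rw [encodeOutput_map]
      exact hr
    · have hpos : 1 ≤ 3 ^ k := Nat.one_le_pow _ _ (by omega)
      rw [Polynomial.eval_mul, Polynomial.eval_ofNat, ← mul_assoc]
      exact Nat.mul_le_mul_right _ (by show 3 ^ (k + 1) + 1 ≤ _; rw [pow_succ]; omega)
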